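/- Let $\varepsilon,\mu:\mathbb R\to(0,\infty)$ be piecewise continuous, $1$-periodic and even ($\varepsilon(-x)=\varepsilon(x)$, $\mu(-x)=\mu(x)$), and let $\mathcal L\psi=-\frac1\varepsilon\big(\frac1\mu\psi'\big)'$; solutions of $\mathcal L\psi=E\psi$ are understood to have $\psi$ and $\frac1\mu\psi'$ continuous. For $k\in[-\pi,\pi]$ let $E_1(k)\le E_2(k)\le\cdots$ be the eigenvalues, counted with multiplicity, of $\mathcal L\psi=E\psi$, $\psi(x+1)=e^{ik}\psi(x)$; nonzero solutions of this problem are called Bloch modes. Put $E_j^-=\min_k E_j(k)$ and $E_j^+=\max_k E_j(k)$. The $j$-th band ($j\ge1$) is isolated if $E_{j-1}^+<E_j^-$ (no condition if $j=1$) and $E_j^+<E_{j+1}^-$. Write $(u,v)_X=\int_0^1\varepsilon u\bar v\,dx$ and $\|\cdot\|_X$ for the corresponding norm. Let $\psi_{E,1},\psi_{E,2}$ be the solutions of $\mathcal L\psi=E\psi$ with $(\psi,\frac1\mu\psi')(0)=(1,0)$ and $(0,1)$, respectively. With $E=E_j(k)$ let $$\phi_{j,k}=\psi_{E,2}(1)\,\psi_{E,1}+(e^{ik}-\psi_{E,1}(1))\,\psi_{E,2},$$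 $$\varphi_{j,k}(x)=\begin{cases}\phi_{j,k}(x)/\|\phi_{j,k}\|_X, & 0\le k\le\pi,\ \phi_{j,k}\not\equiv0,\\ i\psi_{E,2}(x)/\|\psi_{E,2}\|_X, & 0\le k\le\pi,\ \phi_{j,k}\equiv0,\\ \varphi_{j,-k}(-x), & -\pi<k<0,\end{cases}\qquad u_{j,k}(x)=e^{-ikx}\varphi_{j,k}(x).$$ The Zak phase $\theta_j$ of the band is defined modulo $2\pi$ by $$\theta_j=i\int_{-\pi}^0(\partial_ku_{j,k},u_{j,k})_X\,dk+i\int_0^\pi(\partial_ku_{j,k},u_{j,k})_X\,dk-\operatorname{Im}\ln(\varphi_{j,0},\varphi_{j,0^-})_X-\operatorname{Im}\ln(\varphi_{j,(-\pi)^+},\varphi_{j,\pi})_X,$$ where $\varphi_{j,0^-}=\lim_{k\to0^-}\varphi_{j,k}$ and $\varphi_{j,(-\pi)^+}=\lim_{k\to(-\pi)^+}\varphi_{j,k}$, uniformly on $[0,1]$. Suppose that the $j$-th band is isolated. Then the functions $\varphi_{j,k}$, $-\pi<k\le\pi$, are Bloch modes with energy $E_j(k)$ and wavenumber $k$, normalized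 in $X$; each of $\varphi_{j,0}$ and $\varphi_{j,\pi}$ is an even or an odd function; all derivatives, integrals, limits and logarithms in the definition of $\theta_j$ exist; and, modulo $2\pi$, $$\theta_j=\begin{cases}0,&\text{if }\varphi_{j,0}\text{ and }\varphi_{j,\pi}\text{ have the same parity},\\ \pi,&\text{if }\varphi_{j,0}\text{ and }\varphi_{j,\pi}\text{ have different parities}.\end{cases}$$ -/

import Mathlib

/-- Piecewise continuity on the real line: finitely many discontinuities in each bounded interval,
and finite one-sided limits at each point. -/
def PiecewiseContinuous (f : ℝ → ℝ) : Prop :=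
  (∀ a b : ℝ, {x | x ∈ Set.Icc a b ∧ ¬ ContinuousAt f x}.Finite) ∧
    ∀ x : ℝ, (∃ l : ℝ, Filter.Tendsto f (nhdsWithin x (Set.Iio x)) (nhds l)) ∧
      ∃ r : ℝ, Filter.Tendsto f (nhdsWithin x (Set.Ioi x)) (nhds r)

/-- A time-reversal symmetric one-dimensional photonic structure of period one: permittivity `ε`
and permeability `μ` are real, positive, piecewise continuous and one-periodic. The operator is
`L ψ = -(1/ε) ((1/μ) ψ')'`. -/
structure PhotonicStructure where
  ε : ℝ → ℝ
  μ : ℝ → ℝ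
  ε_pos : ∀ x, 0 < ε x
  μ_pos : ∀ x, 0 < μ x
  ε_piecewise : PiecewiseContinuous ε
  μ_piecewise : PiecewiseContinuous μ
  ε_periodic : ∀ x, ε (x + 1) = ε x
  μ_periodic : ∀ x, μ (x + 1) = μ x

namespace PhotonicStructure

/-- `ψ` solves `L ψ = E ψ` on the line with flux `p = (1/μ) ψ'`: both `ψ` and the flux are
continuous everywhere, and `ψ' = μ p`, `p' = -E ε ψ` wherever the coefficients are continuous. -/
structure IsSolution (P : PhotonicStructure) (E : ℝ) (ψ p : ℝ → ℂ) : Prop where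
  continuous_fun : Continuous ψ
  continuous_flux : Continuous p
  hasDerivAt_fun : ∀ x, ContinuousAt P.ε x → ContinuousAt P.μ x →
    HasDerivAt ψ ((P.μ x : ℂ) * p x) x
  hasDerivAt_flux : ∀ x, ContinuousAt P.ε x → ContinuousAt P.μ x →
    HasDerivAt p (-((E : ℂ) * (P.ε x : ℂ) * ψ x)) x

/-- The space of solutions of `L ψ = E ψ`, `ψ (x + 1) = e^{ik} ψ x`; its nonzero elements are the
Bloch modes with wavenumber `k` and energy `E`. -/
def blochSpace (P : PhotonicStructure) (k E : ℝ) : Submodule ℂ (ℝ → ℂ) where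
  carrier := {ψ | (∃ p, P.IsSolution E ψ p) ∧
    ∀ x, ψ (x + 1) = Complex.exp (Complex.I * (k : ℂ)) * ψ x}
  zero_mem' := by
    refine ⟨⟨0, ⟨continuous_const, continuous_const, fun x _ _ => ?_, fun x _ _ => ?_⟩⟩, ?_⟩
    · simp
    · simp
    · simp
  add_mem' := by
    rintro f g ⟨⟨p, hp⟩, hf⟩ ⟨⟨q, hq⟩, hg⟩
    refine ⟨⟨p + q, ⟨hp.1.add hq.1, hp.2.add hq.2, fun x h1 h2 => ?_, fun x h1 h2 => ?_⟩⟩, ?_⟩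
    · refine ((hp.3 x h1 h2).add (hq.3 x h1 h2)).congr_deriv ?_
      simp [mul_add]
    · refine ((hp.4 x h1 h2).add (hq.4 x h1 h2)).congr_deriv ?_
      simp only [Pi.add_apply]
      ring
    · intro x
      simp only [Pi.add_apply, hf x, hg x]
      ring
  smul_mem' := by
    rintro c f ⟨⟨p, hp⟩, hf⟩
    refine ⟨⟨c • p, ⟨hp.1.const_smul c, hp.2.const_smul c, fun x h1 h2 => ?_,
      fun x h1 h2 => ?_⟩⟩, ?_⟩
    · refine ((hp.3 x h1 h2).const_smul c).congr_deriv ?_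
      simp only [Pi.smul_apply, smul_eq_mul]
      ring
    · refine ((hp.4 x h1 h2).const_smul c).congr_deriv ?_
      simp only [Pi.smul_apply, smul_eq_mul]
      ring
    · intro x
      simp only [Pi.smul_apply, smul_eq_mul, hf x]
      ring

/-- Number of eigenvalues not exceeding `E` at wavenumber `k`, counted with multiplicity: an
eigenvalue `e` of multiplicity `m` contributes the pairs `(e, 0), …, (e, m - 1)`. -/
noncomputable def eigenvalueCount (P : PhotonicStructure) (k E : ℝ) : ℕ∞ :=
  Set.encard {q : ℝ × ℕ | q.1 ≤ E ∧ q.2 < Module.finrank ℂ (P.blochSpace k q.1)}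

/-- Dispersion relation `E_j(k)`, for `j ≥ 1`: the `j`-th term of the nondecreasing list
`E_1(k) ≤ E_2(k) ≤ …` of the eigenvalues at wavenumber `k`, repeated by multiplicity. -/
noncomputable def dispersion (P : PhotonicStructure) (j : ℕ) (k : ℝ) : ℝ :=
  sInf {E : ℝ | (j : ℕ∞) ≤ P.eigenvalueCount k E}

/-- `E_j^-`, the minimum of `E_j` over the Brillouin zone. -/
noncomputable def bandMin (P : PhotonicStructure) (j : ℕ) : ℝ :=
  sInf (P.dispersion j '' Set.Icc (-Real.pi) Real.pi)

/-- `E_j^+`, the maximum of `E_j` over the Brillouin zone. -/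
noncomputable def bandMax (P : PhotonicStructure) (j : ℕ) : ℝ :=
  sSup (P.dispersion j '' Set.Icc (-Real.pi) Real.pi)

/-- The `j`-th band (`j ≥ 1`) is isolated: `E_{j-1}^+ < E_j^-` and `E_j^+ < E_{j+1}^-`. There is
no band below the first one, so for `j = 1` only the second inequality is required. -/
def IsIsolatedBand (P : PhotonicStructure) (j : ℕ) : Prop :=
  (1 < j → P.bandMax (j - 1) < P.bandMin j) ∧ P.bandMax j < P.bandMin (j + 1)

/-- The unique solution of `L ψ = E ψ` with `ψ(0) = a` and flux `(1/μ) ψ'` equal to `b` at `0`. -/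
noncomputable def initialValueSolution (P : PhotonicStructure) (E : ℝ) (a b : ℂ) : ℝ → ℂ :=
  Classical.epsilon fun ψ => ∃ p, P.IsSolution E ψ p ∧ ψ 0 = a ∧ p 0 = b

/-- `ψ_{E,1}`. -/
noncomputable def psi1 (P : PhotonicStructure) (E : ℝ) : ℝ → ℂ := P.initialValueSolution E 1 0

/-- `ψ_{E,2}`. -/
noncomputable def psi2 (P : PhotonicStructure) (E : ℝ) : ℝ → ℂ := P.initialValueSolution E 0 1

/-- The weighted inner product `(f, g)_X` on the unit cell. -/
noncomputable def innerX (P : PhotonicStructure) (f g : ℝ → ℂ) : ℂ :=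
  ∫ x in (0 : ℝ)..1, (P.ε x : ℂ) * f x * (starRingEnd ℂ) (g x)

/-- The norm of `X`. -/
noncomputable def normX (P : PhotonicStructure) (f : ℝ → ℂ) : ℝ :=
  Real.sqrt (∫ x in (0 : ℝ)..1, P.ε x * ‖f x‖ ^ 2)

/-- The unnormalized mode
`φ_{j,k} = ψ_{E,2}(1) ψ_{E,1} + (e^{ik} - ψ_{E,1}(1)) ψ_{E,2}` with `E = E_j(k)`. -/
noncomputable def rawMode (P : PhotonicStructure) (j : ℕ) (k : ℝ) : ℝ → ℂ := fun x =>
  P.psi2 (P.dispersion j k) 1 * P.psi1 (P.dispersion j k) x +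
    (Complex.exp (Complex.I * (k : ℂ)) - P.psi1 (P.dispersion j k) 1) *
      P.psi2 (P.dispersion j k) x

open Classical in
/-- The normalized mode for `0 ≤ k ≤ π`; the second alternative is the degenerate case. -/
noncomputable def normalizedMode (P : PhotonicStructure) (j : ℕ) (k : ℝ) : ℝ → ℂ := fun x =>
  if P.rawMode j k ≠ 0 then
    P.rawMode j k x / (P.normX (P.rawMode j k) : ℂ)
  else
    Complex.I * P.psi2 (P.dispersion j k) x / (P.normX (P.psi2 (P.dispersion j k)) : ℂ)

open Classical in
/-- The Bloch gauge over the `j`-th band of an inversion-symmetric structure: the modes on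
`[0, π]` are extended to `-π < k < 0` by `φ_k(x) = φ_{-k}(-x)`. -/
noncomputable def blochMode (P : PhotonicStructure) (j : ℕ) (k : ℝ) : ℝ → ℂ := fun x =>
  if 0 ≤ k then P.normalizedMode j k x else P.normalizedMode j (-k) (-x)

/-- Periodic part `u_k(x) = e^{-ikx} φ_k(x)` of a family of Bloch modes. -/
noncomputable def periodicPart (φ : ℝ → ℝ → ℂ) (k x : ℝ) : ℂ :=
  Complex.exp (-(Complex.I * (k : ℂ) * (x : ℂ))) * φ k x

/-- The derivative `∂u_k/∂k` of the periodic part in the wavenumber. -/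
noncomputable def periodicPartDeriv (φ : ℝ → ℝ → ℂ) (k x : ℝ) : ℂ :=
  deriv (fun κ : ℝ => periodicPart φ κ x) k

/-- The connection `(∂u_k/∂k, u_k)_X`. -/
noncomputable def connection (P : PhotonicStructure) (φ : ℝ → ℝ → ℂ) (k : ℝ) : ℂ :=
  P.innerX (periodicPartDeriv φ k) (periodicPart φ k)

/-- `θ` is the Zak phase, which is defined modulo `2π`, of a piecewise smooth family `φ` of Bloch
modes:
`θ = i ∫_{-π}^0 (∂_k u_k, u_k) dk + i ∫_0^π (∂_k u_k, u_k) dk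
  - Im ln (φ_0, φ_{0^-}) - Im ln (φ_{(-π)^+}, φ_π)  mod 2π`,
where all derivatives, integrals, one-sided limits and logarithms are required to make sense. -/
structure IsZakPhase (P : PhotonicStructure) (φ : ℝ → ℝ → ℂ) (θ : ℝ) : Prop where
  differentiable : ∀ k ∈ Set.Ioo (-Real.pi) 0 ∪ Set.Ioo 0 Real.pi, ∀ x : ℝ,
    DifferentiableAt ℝ (fun κ : ℝ => periodicPart φ κ x) k
  integrable_cell : ∀ k ∈ Set.Ioo (-Real.pi) 0 ∪ Set.Ioo 0 Real.pi,
    IntervalIntegrable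
      (fun x => (P.ε x : ℂ) * periodicPartDeriv φ k x * (starRingEnd ℂ) (periodicPart φ k x))
      MeasureTheory.volume 0 1
  integrable_left : IntervalIntegrable (P.connection φ) MeasureTheory.volume (-Real.pi) 0
  integrable_right : IntervalIntegrable (P.connection φ) MeasureTheory.volume 0 Real.pi
  formula : ∃ v w : ℝ → ℂ,
    TendstoUniformlyOn φ v (nhdsWithin 0 (Set.Iio 0)) (Set.Icc 0 1) ∧
    TendstoUniformlyOn φ w (nhdsWithin (-Real.pi) (Set.Ioi (-Real.pi))) (Set.Icc 0 1) ∧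
    P.innerX (φ 0) v ≠ 0 ∧ P.innerX w (φ Real.pi) ≠ 0 ∧
    ∃ n : ℤ, (θ : ℂ) =
      Complex.I * (∫ k in (-Real.pi)..0, P.connection φ k) +
      Complex.I * (∫ k in (0 : ℝ)..Real.pi, P.connection φ k) -
      ((Complex.log (P.innerX (φ 0) v)).im : ℂ) -
      ((Complex.log (P.innerX w (φ Real.pi))).im : ℂ) +
      (n : ℂ) * (2 * (Real.pi : ℂ))

end PhotonicStructure

/-! Write a = `y1 E 1`, b = `y2 E 1`, c = `q1 E 1` for the real fundamental solutions `y1`, `y2` and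
their fluxes. Even coefficients make `y1` even and `y2` odd, and give the monodromy matrix equal
diagonal entries a, with a² - bc = 1. Hence E is an eigenvalue at k exactly when a(E) = cos k
(`finrank_pos_iff`). On the band e^{ik} - a = i sin k, so the raw mode is b y1 + i sin k y2 and
every normalized mode for 0 ≤ k ≤ π has the form A y1 + i B y2 with A, B real. Reflection in x is
therefore the same as complex conjugation.

This makes the connection vanish (`connection_eq_zero_of_pos`, `connection_eq_zero_of_neg`). Its
real part is half the derivative of the constant norm; and since its integrand is 1-periodic and is
conjugated by x ↦ -x, the integral is real. Only the two overlaps remain. The limits at 0⁻ and (-π)⁺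
are the mirror images of the modes at 0 and π, so each overlap is the parity ±1, and each odd mode
contributes -π to the phase.

Two kinds of regularity are needed. Lagrange's identity yields exact, jointly continuous difference
quotients in E; a'(E) ≠ 0 at a simple eigenvalue with |a| ≤ 1, so E_j is differentiable inside the
zone. At an end k₀ of the half zone b may vanish, but E_j(k) - E_j(k₀) is of order sin² k, so b /
sin k → 0 and the modes tend to i y2 / ‖y2‖, the degenerate choice of gauge
(`tendsto_ratio_of_degenerate`, `tendsto_modeCoeff`).

Finally E_j(k) must be a simple eigenvalue and the only one in a fixed compact energy window
(`IsIsolatedBand.exists_window`). This comes from counting: eigenvalues persist under small changes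
of k, and the isolation inequalities themselves force enough eigenvalues to exist. -/

open MeasureTheory Set Filter Topology

/-! ### Weighted primitives with a discontinuous weight -/

/-- A nonnegative, bounded, measurable coefficient. -/
structure IsCoefficient (B : ℝ) (f : ℝ → ℝ) : Prop where
  meas : AEStronglyMeasurable f volume
  nonneg : ∀ x, 0 ≤ f x
  le : ∀ x, f x ≤ B

namespace IsCoefficient

variable {B : ℝ} {f g : ℝ → ℝ}

lemma bound_nonneg (hf : IsCoefficient B f) : 0 ≤ B := (hf.nonneg 0).trans (hf.le 0)

lemma intervalIntegrable_mul (hf : IsCoefficient B f) {h : ℝ → ℝ} (hh : Continuous h) (a b : ℝ) :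
    IntervalIntegrable (fun t => f t * h t) volume a b := by
  have hb : ∀ x, ‖f x‖ ≤ B := fun x => by
    rw [Real.norm_of_nonneg (hf.nonneg x)]; exact hf.le x
  have h := hh.intervalIntegrable (μ := volume) a b
  exact ⟨h.1.bdd_mul hf.meas.restrict (Eventually.of_forall hb),
    h.2.bdd_mul hf.meas.restrict (Eventually.of_forall hb)⟩

lemma intervalIntegrable_mul_complex (hf : IsCoefficient B f) {h : ℝ → ℂ} (hh : Continuous h)
    (a b : ℝ) : IntervalIntegrable (fun t => (f t : ℂ) * h t) volume a b := by
  have hb : ∀ x, ‖(f x : ℂ)‖ ≤ B := fun x => by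
    rw [Complex.norm_real, Real.norm_of_nonneg (hf.nonneg x)]; exact hf.le x
  have hm := Complex.continuous_ofReal.comp_aestronglyMeasurable hf.meas
  have h := hh.intervalIntegrable (μ := volume) a b
  exact ⟨h.1.bdd_mul hm.restrict (Eventually.of_forall hb),
    h.2.bdd_mul hm.restrict (Eventually.of_forall hb)⟩

lemma continuous_primitive (hf : IsCoefficient B f) {h : ℝ → ℝ} (hh : Continuous h) :
    Continuous fun x => ∫ t in (0 : ℝ)..x, f t * h t :=
  intervalIntegral.continuous_primitive (fun a b => hf.intervalIntegrable_mul hh a b) 0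

lemma hasDerivAt_primitive (hf : IsCoefficient B f) {h : ℝ → ℝ} (hh : Continuous h) {x : ℝ}
    (hx : ContinuousAt f x) :
    HasDerivAt (fun x => ∫ t in (0 : ℝ)..x, f t * h t) (f x * h x) x :=
  intervalIntegral.integral_hasDerivAt_right (hf.intervalIntegrable_mul hh 0 x)
    ⟨univ, univ_mem, (hf.meas.mul hh.aestronglyMeasurable).restrict⟩ (hx.mul hh.continuousAt)

/-- The measure `f dx`. -/
noncomputable def measure (f : ℝ → ℝ) : Measure ℝ :=
  volume.withDensity fun x => ENNReal.ofReal (f x)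

lemma isLocallyFiniteMeasure (hf : IsCoefficient B f) : IsLocallyFiniteMeasure (measure f) := by
  have hle : measure f ≤ ENNReal.ofReal B • volume := by
    rw [← withDensity_const]
    exact withDensity_mono (Eventually.of_forall fun x => ENNReal.ofReal_le_ofReal (hf.le x))
  have : IsLocallyFiniteMeasure (B.toNNReal • (volume : Measure ℝ)) := inferInstance
  exact Measure.isLocallyFiniteMeasure_of_le (μ := B.toNNReal • (volume : Measure ℝ)) hle

lemma nullSingletonClass : NullSingletonClass (measure f) :=
  ⟨fun x => withDensity_absolutelyContinuous _ _ (measure_singleton x)⟩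

lemma integral_measure (hf : IsCoefficient B f) (h : ℝ → ℝ) (a b : ℝ) :
    ∫ t in a..b, h t ∂(measure f) = ∫ t in a..b, f t * h t := by
  have key : ∀ s : Set ℝ, MeasurableSet s →
      ∫ t in s, h t ∂(measure f) = ∫ t in s, f t * h t := by
    intro s hs
    rw [measure, setIntegral_withDensity_eq_setIntegral_toReal_smul₀ _ _ _ hs]
    · refine integral_congr_ae (Eventually.of_forall fun x => ?_)
      simp [ENNReal.toReal_ofReal (hf.nonneg x)]
    · exact hf.meas.aemeasurable.ennreal_ofReal.restrict
    · exact Eventually.of_forall fun x => ENNReal.ofReal_lt_top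
  simp only [intervalIntegral, key _ measurableSet_Ioc]

/-- Weighted primitives depend jointly continuously on a parameter and on the end point. -/
lemma continuous_parametric_primitive (hf : IsCoefficient B f) {X : Type*} [TopologicalSpace X]
    [FirstCountableTopology X] {F : X → ℝ → ℝ} (hF : Continuous fun p : X × ℝ => F p.1 p.2) :
    Continuous fun p : X × ℝ => ∫ t in (0 : ℝ)..p.2, f t * F p.1 t := by
  have := hf.isLocallyFiniteMeasure
  have : NullSingletonClass (measure f) := nullSingletonClass
  -- The weight is only measurable; absorbed into the measure, it leaves a jointly continuous
  -- integrand.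
  have := intervalIntegral.continuous_parametric_primitive_of_continuous (μ := measure f)
    (a₀ := 0) (f := F) hF
  simpa only [hf.integral_measure] using this

end IsCoefficient

/-! ### Iterated primitives and the power series in the energy -/

/-- Alternating iterated primitives `∫ f ∫ g ∫ f …` of the constant function `1`. -/
noncomputable def iteratedPrimitive : ℕ → (ℝ → ℝ) → (ℝ → ℝ) → ℝ → ℝ
  | 0, _, _ => fun _ => 1
  | n + 1, f, g => fun x => ∫ t in (0 : ℝ)..x, f t * iteratedPrimitive n g f t

section iteratedPrimitive

variable {B : ℝ} {f g : ℝ → ℝ}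

lemma iteratedPrimitive_succ (n : ℕ) (f g : ℝ → ℝ) (x : ℝ) :
    iteratedPrimitive (n + 1) f g x = ∫ t in (0 : ℝ)..x, f t * iteratedPrimitive n g f t := rfl

lemma continuous_iteratedPrimitive (n : ℕ) (hf : IsCoefficient B f) (hg : IsCoefficient B g) :
    Continuous (iteratedPrimitive n f g) := by
  induction n generalizing f g with
  | zero => exact continuous_const
  | succ n ih => exact hf.continuous_primitive (ih hg hf)

/-- Each integration contributes a factor B and raises the power of |t| by one, as in an exponential
series. -/
lemma abs_iteratedPrimitive_le (n : ℕ) (hf : IsCoefficient B f) (hg : IsCoefficient B g) (x : ℝ) :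
    |iteratedPrimitive n f g x| ≤ (B * |x|) ^ n / n.factorial := by
  induction n generalizing f g x with
  | zero => simp [iteratedPrimitive]
  | succ n ih =>
    have hB := hf.bound_nonneg
    rw [iteratedPrimitive_succ, ← Real.norm_eq_abs]
    refine (intervalIntegral.norm_integral_le_abs_of_norm_le
      (g := fun t => B * ((B * |t|) ^ n / n.factorial)) ?_ ?_).trans ?_
    · refine Eventually.of_forall fun t => ?_
      rw [norm_mul, Real.norm_of_nonneg (hf.nonneg t), Real.norm_eq_abs]
      exact mul_le_mul (hf.le t) (ih hg hf t) (abs_nonneg _) hB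
    · exact Continuous.intervalIntegrable (by fun_prop) _ _
    · have h1 := integral_pow_abs_sub_uIoc (a := 0) (b := x) (n := n)
      have h2 : ∀ t : ℝ, B * ((B * |t|) ^ n / n.factorial)
          = B ^ (n + 1) / n.factorial * |t - 0| ^ n := by
        intro t; rw [sub_zero, mul_pow]; ring
      simp only [h2]
      rw [intervalIntegral.integral_const_mul, abs_mul, intervalIntegral.abs_intervalIntegral_eq,
        h1, sub_zero, abs_of_nonneg (by positivity), abs_of_nonneg (by positivity),
        Nat.factorial_succ]
      push_cast
      apply le_of_eq
      rw [mul_pow]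
      field_simp

lemma iteratedPrimitive_nonneg (n : ℕ) (hf : IsCoefficient B f) (hg : IsCoefficient B g) {x : ℝ}
    (hx : 0 ≤ x) : 0 ≤ iteratedPrimitive n f g x := by
  induction n generalizing f g x with
  | zero => simp [iteratedPrimitive]
  | succ n ih =>
    exact intervalIntegral.integral_nonneg hx fun t ht => mul_nonneg (hf.nonneg t) (ih hg hf ht.1)

/-- Reversing the integration variable costs one sign per integral. This is the source of the parity
of `y1` and `y2`. -/
lemma iteratedPrimitive_neg (n : ℕ) (hf : ∀ x, f (-x) = f x) (hg : ∀ x, g (-x) = g x) (x : ℝ) :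
    iteratedPrimitive n f g (-x) = (-1) ^ n * iteratedPrimitive n f g x := by
  induction n generalizing f g x with
  | zero => simp [iteratedPrimitive]
  | succ n ih =>
    have h := intervalIntegral.integral_comp_neg (a := 0) (b := x)
      (fun t => f t * iteratedPrimitive n g f t)
    rw [neg_zero] at h
    rw [iteratedPrimitive_succ, iteratedPrimitive_succ, intervalIntegral.integral_symm, ← h,
      ← intervalIntegral.integral_const_mul, ← intervalIntegral.integral_neg]
    refine intervalIntegral.integral_congr fun t _ => ?_
    simp only [hf, ih hg hf]
    ring

end iteratedPrimitive

/-- The generalized trigonometric series `∑ (-E)ⁿ H_{2n+r}`, where `H_m` are the alternating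
iterated primitives. -/
noncomputable def primitiveSeries (r : ℕ) (f g : ℝ → ℝ) (E x : ℝ) : ℝ :=
  ∑' n : ℕ, (-E) ^ n * iteratedPrimitive (2 * n + r) f g x

section primitiveSeries

variable {B : ℝ} {f g : ℝ → ℝ}

/-- The factorial (2n + r)! is replaced by the smaller n!, which is crude but still summable and
uniform for |E|, |x| ≤ R. -/
lemma abs_primitiveSeries_term_le (r : ℕ) (hf : IsCoefficient B f) (hg : IsCoefficient B g)
    {R E x : ℝ} (hE : |E| ≤ R) (hx : |x| ≤ R) (n : ℕ) :
    |(-E) ^ n * iteratedPrimitive (2 * n + r) f g x| ≤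
      (B * R) ^ r * ((R * (B * R) ^ 2) ^ n / n.factorial) := by
  have hB := hf.bound_nonneg
  have hR := (abs_nonneg E).trans hE
  rw [abs_mul, abs_pow, abs_neg]
  calc |E| ^ n * |iteratedPrimitive (2 * n + r) f g x|
      ≤ R ^ n * ((B * R) ^ (2 * n + r) / (n.factorial : ℝ)) := by
        refine mul_le_mul (pow_le_pow_left₀ (abs_nonneg _) hE n) ?_ (abs_nonneg _) (by positivity)
        refine (abs_iteratedPrimitive_le _ hf hg x).trans ?_
        refine div_le_div₀ (by positivity) ?_ (by positivity) ?_
        · gcongr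
        · exact_mod_cast Nat.factorial_le (by omega)
    _ = _ := by rw [pow_add, pow_mul, mul_pow R]; ring

lemma summable_primitiveSeries_bound (r : ℕ) (B R : ℝ) :
    Summable fun n : ℕ => (B * R) ^ r * ((R * (B * R) ^ 2) ^ n / n.factorial) :=
  (Real.summable_pow_div_factorial _).mul_left _

lemma summable_primitiveSeries (r : ℕ) (hf : IsCoefficient B f) (hg : IsCoefficient B g)
    (E x : ℝ) : Summable fun n : ℕ => (-E) ^ n * iteratedPrimitive (2 * n + r) f g x :=
  Summable.of_norm_bounded (summable_primitiveSeries_bound r B (max |E| |x|))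
    fun n => abs_primitiveSeries_term_le r hf hg (le_max_left _ _) (le_max_right _ _) n

lemma continuous_primitiveSeries (r : ℕ) (hf : IsCoefficient B f) (hg : IsCoefficient B g) :
    Continuous fun p : ℝ × ℝ => primitiveSeries r f g p.1 p.2 := by
  rw [continuous_iff_continuousAt]
  intro p
  have hc : ContinuousOn (fun p : ℝ × ℝ => primitiveSeries r f g p.1 p.2)
      (Metric.ball 0 (‖p‖ + 1)) := by
    refine continuousOn_tsum (fun n => Continuous.continuousOn ?_)
      (summable_primitiveSeries_bound r B (‖p‖ + 1)) ?_
    · have := continuous_iteratedPrimitive (2 * n + r) hf hg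
      fun_prop
    · intro n q hq
      rw [mem_ball_zero_iff] at hq
      exact abs_primitiveSeries_term_le r hf hg ((norm_fst_le q).trans hq.le)
        ((norm_snd_le q).trans hq.le) n
  exact hc.continuousAt (Metric.isOpen_ball.mem_nhds (by simp))

/-- Termwise integration by dominated convergence. With `primitiveSeries_zero` this is the
first-order system for a solution and its flux, in integrated form. -/
lemma primitiveSeries_one (hf : IsCoefficient B f) (hg : IsCoefficient B g) (E x : ℝ) :
    primitiveSeries 1 f g E x = ∫ t in (0 : ℝ)..x, f t * primitiveSeries 0 g f E t := by
  have hB := hf.bound_nonneg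
  set R := max |E| |x|
  have key := intervalIntegral.hasSum_integral_of_dominated_convergence (μ := volume)
    (a := 0) (b := x)
    (F := fun (n : ℕ) t => f t * ((-E) ^ n * iteratedPrimitive (2 * n + 0) g f t))
    (f := fun t => f t * primitiveSeries 0 g f E t)
    (fun n _ => B * ((B * R) ^ 0 * ((R * (B * R) ^ 2) ^ n / n.factorial))) ?_ ?_ ?_ ?_ ?_
  · rw [← key.tsum_eq, primitiveSeries]
    refine tsum_congr fun n => ?_
    rw [iteratedPrimitive_succ, ← intervalIntegral.integral_const_mul]
    refine intervalIntegral.integral_congr fun t _ => ?_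
    simp only [add_zero]
    ring
  · intro n
    have := continuous_iteratedPrimitive (2 * n + 0) hg hf
    exact (hf.meas.mul (Continuous.aestronglyMeasurable (by fun_prop))).restrict
  · intro n
    refine Eventually.of_forall fun t ht => ?_
    rw [norm_mul, Real.norm_of_nonneg (hf.nonneg t)]
    refine mul_le_mul (hf.le t) ?_ (norm_nonneg _) hB
    refine abs_primitiveSeries_term_le 0 hg hf (le_max_left _ _) ?_ n
    refine le_trans ?_ (le_max_right _ _)
    have := abs_sub_left_of_mem_uIcc (uIoc_subset_uIcc ht)
    simpa using this
  · exact Eventually.of_forall fun t _ => (summable_primitiveSeries_bound 0 B R).mul_left _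
  · simp
  · exact Eventually.of_forall fun t _ =>
      ((summable_primitiveSeries 0 hg hf E t).hasSum).mul_left _

lemma primitiveSeries_zero (hf : IsCoefficient B f) (hg : IsCoefficient B g) (E x : ℝ) :
    primitiveSeries 0 f g E x = 1 - E * ∫ t in (0 : ℝ)..x, f t * primitiveSeries 1 g f E t := by
  have hB := hf.bound_nonneg
  set R := max |E| |x|
  have key := intervalIntegral.hasSum_integral_of_dominated_convergence (μ := volume)
    (a := 0) (b := x)
    (F := fun (n : ℕ) t => f t * ((-E) ^ n * iteratedPrimitive (2 * n + 1) g f t))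
    (f := fun t => f t * primitiveSeries 1 g f E t)
    (fun n _ => B * ((B * R) ^ 1 * ((R * (B * R) ^ 2) ^ n / n.factorial))) ?_ ?_ ?_ ?_ ?_
  -- Once the constant term is split off, the even term of index n + 1 is -E times the integral of
  -- the odd term of index n.
  · rw [← key.tsum_eq, primitiveSeries, (summable_primitiveSeries 0 hf hg E x).tsum_eq_zero_add,
      sub_eq_add_neg, ← neg_mul, ← tsum_mul_left]
    congr 1
    · simp [iteratedPrimitive]
    · refine tsum_congr fun n => ?_
      rw [show 2 * (n + 1) + 0 = 2 * n + 1 + 1 by ring, iteratedPrimitive_succ,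
        ← intervalIntegral.integral_const_mul, ← intervalIntegral.integral_const_mul]
      refine intervalIntegral.integral_congr fun t _ => ?_
      ring
  · intro n
    have := continuous_iteratedPrimitive (2 * n + 1) hg hf
    exact (hf.meas.mul (Continuous.aestronglyMeasurable (by fun_prop))).restrict
  · intro n
    refine Eventually.of_forall fun t ht => ?_
    rw [norm_mul, Real.norm_of_nonneg (hf.nonneg t)]
    refine mul_le_mul (hf.le t) ?_ (norm_nonneg _) hB
    refine abs_primitiveSeries_term_le 1 hg hf (le_max_left _ _) ?_ n
    refine le_trans ?_ (le_max_right _ _)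
    have := abs_sub_left_of_mem_uIcc (uIoc_subset_uIcc ht)
    simpa using this
  · exact Eventually.of_forall fun t _ => (summable_primitiveSeries_bound 1 B R).mul_left _
  · simp
  · exact Eventually.of_forall fun t _ =>
      ((summable_primitiveSeries 1 hg hf E t).hasSum).mul_left _

lemma continuous_primitiveSeries_apply (r : ℕ) (hf : IsCoefficient B f) (hg : IsCoefficient B g)
    (E : ℝ) : Continuous (primitiveSeries r f g E) :=
  (continuous_primitiveSeries r hf hg).comp (Continuous.prodMk_right E)

lemma hasDerivAt_primitiveSeries_one (hf : IsCoefficient B f) (hg : IsCoefficient B g) (E : ℝ)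
    {x : ℝ} (hx : ContinuousAt f x) :
    HasDerivAt (primitiveSeries 1 f g E) (f x * primitiveSeries 0 g f E x) x := by
  rw [funext (primitiveSeries_one hf hg E)]
  exact hf.hasDerivAt_primitive (continuous_primitiveSeries_apply 0 hg hf E) hx

lemma hasDerivAt_primitiveSeries_zero (hf : IsCoefficient B f) (hg : IsCoefficient B g) (E : ℝ)
    {x : ℝ} (hx : ContinuousAt f x) :
    HasDerivAt (primitiveSeries 0 f g E) (-(E * (f x * primitiveSeries 1 g f E x))) x := by
  rw [funext (primitiveSeries_zero hf hg E)]
  exact ((hf.hasDerivAt_primitive (continuous_primitiveSeries_apply 1 hg hf E) hx).const_mul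
    E).const_sub 1

lemma primitiveSeries_neg (r : ℕ) (hf : ∀ x, f (-x) = f x) (hg : ∀ x, g (-x) = g x) (E x : ℝ) :
    primitiveSeries r f g E (-x) = (-1) ^ r * primitiveSeries r f g E x := by
  rw [primitiveSeries, primitiveSeries, ← tsum_mul_left]
  refine tsum_congr fun n => ?_
  rw [iteratedPrimitive_neg _ hf hg, pow_add, pow_mul, neg_one_sq, one_pow]
  ring

/-- For negative energies the even series is larger than one. -/
lemma one_lt_primitiveSeries_zero (hf : IsCoefficient B f) (hg : IsCoefficient B g)
    (hf' : ∀ x, 0 < f x) (hg' : ∀ x, 0 < g x) {E x : ℝ} (hE : E < 0) (hx : 0 < x) :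
    1 < primitiveSeries 0 f g E x := by
  have hpos : ∀ y, 0 < y → 0 < iteratedPrimitive 1 g f y := fun y hy =>
    intervalIntegral.intervalIntegral_pos_of_pos_on
      (hg.intervalIntegrable_mul (continuous_iteratedPrimitive 0 hf hg) 0 y)
      (fun t _ => by simpa [iteratedPrimitive] using hg' t) hy
  have h2 : 0 < iteratedPrimitive 2 f g x :=
    intervalIntegral.intervalIntegral_pos_of_pos_on
      (hf.intervalIntegrable_mul (continuous_iteratedPrimitive 1 hg hf) 0 x)
      (fun t ht => mul_pos (hf' t) (hpos t ht.1)) hx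
  have hs := (summable_primitiveSeries 0 hf hg E x)
  -- As -E > 0, all terms are nonnegative, so the sum dominates its first two: 1 and a positive
  -- multiple of H₂.
  have hle := hs.sum_le_tsum (Finset.range 2) fun n _ =>
    mul_nonneg (pow_nonneg (by linarith) n) (iteratedPrimitive_nonneg _ hf hg hx.le)
  rw [Finset.sum_range_succ, Finset.sum_range_one] at hle
  have : 0 < (-E) * iteratedPrimitive 2 f g x := mul_pos (by linarith) h2
  have h0 : iteratedPrimitive 0 f g x = 1 := rfl
  simp only [pow_zero, pow_one, mul_zero, mul_one, add_zero, h0] at hle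
  exact (by linarith : (1 : ℝ) < 1 + (-E) * iteratedPrimitive 2 f g x).trans_le hle

end primitiveSeries

/-! ### Piecewise continuous periodic coefficients -/

namespace PiecewiseContinuous

variable {f : ℝ → ℝ}

lemma countable_discontinuities (hf : PiecewiseContinuous f) :
    {x | ¬ ContinuousAt f x}.Countable := by
  have : {x | ¬ ContinuousAt f x} ⊆
      ⋃ n : ℕ, {x | x ∈ Icc (-(n : ℝ)) n ∧ ¬ ContinuousAt f x} := by
    intro x hx
    obtain ⟨n, hn⟩ := exists_nat_ge |x|
    exact mem_iUnion.2 ⟨n, abs_le.1 hn, hx⟩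
  exact (countable_iUnion fun n => (hf.1 _ _).countable).mono this

lemma aestronglyMeasurable (hf : PiecewiseContinuous f) : AEStronglyMeasurable f volume := by
  have hc := hf.countable_discontinuities
  have hon : ContinuousOn f {x | ¬ ContinuousAt f x}ᶜ := fun x hx =>
    (not_not.1 hx : ContinuousAt f x).continuousWithinAt
  have h := hon.aestronglyMeasurable (μ := volume) hc.measurableSet.compl
  rwa [Measure.restrict_eq_self_of_ae_mem] at h
  exact hc.ae_notMem volume

/-- The one-sided limits and the value at the point bound f near each point; compactness of one
period and periodicity do the rest. -/
lemma exists_bound_of_periodic (hf : PiecewiseContinuous f) (hper : ∀ x, f (x + 1) = f x) :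
    ∃ B, ∀ x, f x ≤ B := by
  have hloc : ∀ x, ∃ C, ∀ᶠ y in 𝓝 x, f y ≤ C := by
    intro x
    obtain ⟨⟨l, hl⟩, r, hr⟩ := hf.2 x
    refine ⟨max (max (l + 1) (r + 1)) (f x), ?_⟩
    rw [← nhdsNE_sup_pure, ← nhdsLT_sup_nhdsGT]
    simp only [eventually_sup, eventually_pure]
    refine ⟨⟨?_, ?_⟩, le_max_right _ _⟩
    · filter_upwards [hl.eventually (gt_mem_nhds (lt_add_one l))] with y hy
      exact hy.le.trans ((le_max_left _ _).trans (le_max_left _ _))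
    · filter_upwards [hr.eventually (gt_mem_nhds (lt_add_one r))] with y hy
      exact hy.le.trans ((le_max_right _ _).trans (le_max_left _ _))
  obtain ⟨B, hB⟩ : ∃ B, ∀ y ∈ Icc (0 : ℝ) 1, f y ≤ B := by
    refine isCompact_Icc.induction_on (p := fun s => ∃ B, ∀ y ∈ s, f y ≤ B) ⟨0, by simp⟩ ?_ ?_ ?_
    · rintro s t hst ⟨B, hB⟩
      exact ⟨B, fun y hy => hB y (hst hy)⟩
    · rintro s t ⟨B, hB⟩ ⟨C, hC⟩
      refine ⟨max B C, ?_⟩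
      rintro y (hy | hy)
      · exact (hB y hy).trans (le_max_left _ _)
      · exact (hC y hy).trans (le_max_right _ _)
    · intro x _
      obtain ⟨C, hC⟩ := hloc x
      exact ⟨_, mem_nhdsWithin_of_mem_nhds hC, C, fun y hy => hy⟩
  refine ⟨B, fun x => ?_⟩
  have hp : Function.Periodic f 1 := hper
  rw [← hp.sub_int_mul_eq ⌊x⌋, mul_one]
  exact hB _ ⟨Int.fract_nonneg x, (Int.fract_lt_one x).le⟩

end PiecewiseContinuous

/-! ### Fundamental solutions, uniqueness and monodromy -/

/-- A continuous function whose derivative is known off a countable set is the integral of that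
derivative. -/
lemma eq_add_integral_of_hasDerivAt_off_countable {E : Type*} [NormedAddCommGroup E]
    [NormedSpace ℝ E] [CompleteSpace E] {F F' : ℝ → E} {s : Set ℝ} (hs : s.Countable)
    (hF : Continuous F) (hd : ∀ x, x ∉ s → HasDerivAt F (F' x) x)
    (hi : ∀ a b : ℝ, IntervalIntegrable F' volume a b) (x : ℝ) :
    F x = F 0 + ∫ t in (0 : ℝ)..x, F' t := by
  rw [MeasureTheory.integral_eq_of_hasDerivAt_off_countable F F' hs hF.continuousOn
    (fun y hy => hd y hy.2) (hi 0 x)]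
  abel

namespace PhotonicStructure

variable (P : PhotonicStructure)

lemma exists_isCoefficient : ∃ B, IsCoefficient B P.ε ∧ IsCoefficient B P.μ := by
  obtain ⟨B, hB⟩ := P.ε_piecewise.exists_bound_of_periodic P.ε_periodic
  obtain ⟨C, hC⟩ := P.μ_piecewise.exists_bound_of_periodic P.μ_periodic
  exact ⟨max B C, ⟨P.ε_piecewise.aestronglyMeasurable, fun x => (P.ε_pos x).le,
    fun x => (hB x).trans (le_max_left _ _)⟩, ⟨P.μ_piecewise.aestronglyMeasurable,
    fun x => (P.μ_pos x).le, fun x => (hC x).trans (le_max_right _ _)⟩⟩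

/-- A common bound of the coefficients. -/
noncomputable def coeffBound : ℝ := P.exists_isCoefficient.choose

lemma isCoefficient_ε : IsCoefficient P.coeffBound P.ε := P.exists_isCoefficient.choose_spec.1

lemma isCoefficient_μ : IsCoefficient P.coeffBound P.μ := P.exists_isCoefficient.choose_spec.2

/-- Points at which a coefficient is discontinuous. -/
def singularSet : Set ℝ := {x | ¬ (ContinuousAt P.ε x ∧ ContinuousAt P.μ x)}

lemma countable_singularSet : P.singularSet.Countable := by
  refine (P.ε_piecewise.countable_discontinuities.union
    P.μ_piecewise.countable_discontinuities).mono fun x hx => ?_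
  by_contra h
  simp only [mem_union, mem_ofPred_eq, not_or, not_not] at h
  exact hx h

variable {P}

lemma regular_of_notMem {x : ℝ} (hx : x ∉ P.singularSet) :
    ContinuousAt P.ε x ∧ ContinuousAt P.μ x := not_not.1 hx

variable (P)

/-- A real solution with its flux. -/
structure IsRealSolution (E : ℝ) (f q : ℝ → ℝ) : Prop where
  continuous_fun : Continuous f
  continuous_flux : Continuous q
  hasDerivAt_fun : ∀ x, x ∉ P.singularSet → HasDerivAt f (P.μ x * q x) x
  hasDerivAt_flux : ∀ x, x ∉ P.singularSet → HasDerivAt q (-(E * P.ε x * f x)) x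

/-- The real form of the solution with initial data `(1, 0)`. -/
noncomputable def y1 (E x : ℝ) : ℝ := primitiveSeries 0 P.μ P.ε E x

/-- The flux of `y1`. -/
noncomputable def q1 (E x : ℝ) : ℝ := -(E * primitiveSeries 1 P.ε P.μ E x)

/-- The real form of the solution with initial data `(0, 1)`. -/
noncomputable def y2 (E x : ℝ) : ℝ := primitiveSeries 1 P.μ P.ε E x

/-- The flux of `y2`. -/
noncomputable def q2 (E x : ℝ) : ℝ := primitiveSeries 0 P.ε P.μ E x

@[fun_prop]
lemma continuous_y1 : Continuous fun p : ℝ × ℝ => P.y1 p.1 p.2 :=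
  continuous_primitiveSeries 0 P.isCoefficient_μ P.isCoefficient_ε

@[fun_prop]
lemma continuous_y2 : Continuous fun p : ℝ × ℝ => P.y2 p.1 p.2 :=
  continuous_primitiveSeries 1 P.isCoefficient_μ P.isCoefficient_ε

@[fun_prop]
lemma continuous_q1 : Continuous fun p : ℝ × ℝ => P.q1 p.1 p.2 :=
  (continuous_fst.mul (continuous_primitiveSeries 1 P.isCoefficient_ε P.isCoefficient_μ)).neg

@[fun_prop]
lemma continuous_q2 : Continuous fun p : ℝ × ℝ => P.q2 p.1 p.2 :=
  continuous_primitiveSeries 0 P.isCoefficient_ε P.isCoefficient_μ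

@[fun_prop]
lemma _root_.Continuous.y1 {X : Type*} [TopologicalSpace X] {u v : X → ℝ} (hu : Continuous u)
    (hv : Continuous v) : Continuous fun x => P.y1 (u x) (v x) :=
  P.continuous_y1.comp (hu.prodMk hv)

@[fun_prop]
lemma _root_.Continuous.y2 {X : Type*} [TopologicalSpace X] {u v : X → ℝ} (hu : Continuous u)
    (hv : Continuous v) : Continuous fun x => P.y2 (u x) (v x) :=
  P.continuous_y2.comp (hu.prodMk hv)

@[fun_prop]
lemma _root_.Continuous.q1 {X : Type*} [TopologicalSpace X] {u v : X → ℝ} (hu : Continuous u)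
    (hv : Continuous v) : Continuous fun x => P.q1 (u x) (v x) :=
  P.continuous_q1.comp (hu.prodMk hv)

@[fun_prop]
lemma _root_.Continuous.q2 {X : Type*} [TopologicalSpace X] {u v : X → ℝ} (hu : Continuous u)
    (hv : Continuous v) : Continuous fun x => P.q2 (u x) (v x) :=
  P.continuous_q2.comp (hu.prodMk hv)

@[simp] lemma y1_zero (E : ℝ) : P.y1 E 0 = 1 := by
  rw [y1, primitiveSeries_zero P.isCoefficient_μ P.isCoefficient_ε]; simp

@[simp] lemma y2_zero (E : ℝ) : P.y2 E 0 = 0 := by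
  rw [y2, primitiveSeries_one P.isCoefficient_μ P.isCoefficient_ε]; simp

@[simp] lemma q1_zero (E : ℝ) : P.q1 E 0 = 0 := by
  rw [q1, primitiveSeries_one P.isCoefficient_ε P.isCoefficient_μ]; simp

@[simp] lemma q2_zero (E : ℝ) : P.q2 E 0 = 1 := by
  rw [q2, primitiveSeries_zero P.isCoefficient_ε P.isCoefficient_μ]; simp

lemma isRealSolution_one (E : ℝ) : P.IsRealSolution E (P.y1 E) (P.q1 E) where
  continuous_fun := by fun_prop
  continuous_flux := by fun_prop
  hasDerivAt_fun x hx := by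
    refine (hasDerivAt_primitiveSeries_zero P.isCoefficient_μ P.isCoefficient_ε E
      (regular_of_notMem hx).2).congr_deriv ?_
    rw [q1]; ring
  hasDerivAt_flux x hx := by
    refine ((hasDerivAt_primitiveSeries_one P.isCoefficient_ε P.isCoefficient_μ E
      (regular_of_notMem hx).1).const_mul E).neg.congr_deriv ?_
    rw [y1]; ring

lemma isRealSolution_two (E : ℝ) : P.IsRealSolution E (P.y2 E) (P.q2 E) where
  continuous_fun := by fun_prop
  continuous_flux := by fun_prop
  hasDerivAt_fun x hx := hasDerivAt_primitiveSeries_one P.isCoefficient_μ P.isCoefficient_ε E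
    (regular_of_notMem hx).2
  hasDerivAt_flux x hx := by
    refine (hasDerivAt_primitiveSeries_zero P.isCoefficient_ε P.isCoefficient_μ E
      (regular_of_notMem hx).1).congr_deriv ?_
    rw [y2]; ring

variable {P}

/-- Lagrange identity. -/
lemma IsRealSolution.lagrange {E E' : ℝ} {f q g r : ℝ → ℝ} (h : P.IsRealSolution E f q)
    (h' : P.IsRealSolution E' g r) (x : ℝ) :
    f x * r x - g x * q x = f 0 * r 0 - g 0 * q 0 +
      (E - E') * ∫ t in (0 : ℝ)..x, P.ε t * (f t * g t) := by
  have c1 := h.continuous_fun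
  have c2 := h.continuous_flux
  have c3 := h'.continuous_fun
  have c4 := h'.continuous_flux
  rw [← intervalIntegral.integral_const_mul]
  refine eq_add_integral_of_hasDerivAt_off_countable (F := fun x => f x * r x - g x * q x)
    P.countable_singularSet (by fun_prop) (fun y hy => ?_)
    (fun a b => (P.isCoefficient_ε.intervalIntegrable_mul (by fun_prop) a b).const_mul _) x
  refine (((h.hasDerivAt_fun y hy).mul (h'.hasDerivAt_flux y hy)).sub
    ((h'.hasDerivAt_fun y hy).mul (h.hasDerivAt_flux y hy))).congr_deriv ?_
  ring

variable (P)

lemma wronskian (E x : ℝ) : P.y1 E x * P.q2 E x - P.y2 E x * P.q1 E x = 1 := by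
  have := (P.isRealSolution_one E).lagrange (P.isRealSolution_two E) x
  simpa using this

variable {P}

/-- A complex solution and a real one have constant Wronskian. -/
lemma IsSolution.wronskian_real {E : ℝ} {ψ p : ℝ → ℂ} {g r : ℝ → ℝ} (h : P.IsSolution E ψ p)
    (h' : P.IsRealSolution E g r) (x : ℝ) :
    ψ x * r x - g x * p x = ψ 0 * r 0 - g 0 * p 0 := by
  have c1 := h.continuous_fun
  have c2 := h.continuous_flux
  have c3 := h'.continuous_fun
  have c4 := h'.continuous_flux
  have := eq_add_integral_of_hasDerivAt_off_countable
    (F := fun x => ψ x * r x - g x * p x) (F' := fun _ => 0)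
    P.countable_singularSet (by fun_prop) (fun y hy => ?_) (fun a b => by simp) x
  · simpa using this
  have hr := regular_of_notMem hy
  refine (((h.hasDerivAt_fun y hr.1 hr.2).mul (h'.hasDerivAt_flux y hy).ofReal_comp).sub
    ((h'.hasDerivAt_fun y hy).ofReal_comp.mul (h.hasDerivAt_flux y hr.1 hr.2))).congr_deriv ?_
  push_cast
  ring

/-- The Wronskians of ψ with `y1` and `y2` are constant, and Cramer's rule with determinant 1
recovers ψ from them. This is the uniqueness theorem for the initial value problem. -/
lemma IsSolution.eq_fun {E : ℝ} {ψ p : ℝ → ℂ} (h : P.IsSolution E ψ p) (x : ℝ) :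
    ψ x = ψ 0 * P.y1 E x + p 0 * P.y2 E x := by
  have h1 := h.wronskian_real (P.isRealSolution_one E) x
  have h2 := h.wronskian_real (P.isRealSolution_two E) x
  have hw : (P.y1 E x * P.q2 E x - P.y2 E x * P.q1 E x : ℂ) = 1 := by
    exact_mod_cast P.wronskian E x
  simp only [y1_zero, y2_zero, q1_zero, q2_zero] at h1 h2
  push_cast at h1 h2
  linear_combination (-ψ x) * hw - P.y2 E x * h1 + P.y1 E x * h2

lemma IsSolution.eq_flux {E : ℝ} {ψ p : ℝ → ℂ} (h : P.IsSolution E ψ p) (x : ℝ) :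
    p x = ψ 0 * P.q1 E x + p 0 * P.q2 E x := by
  have h1 := h.wronskian_real (P.isRealSolution_one E) x
  have h2 := h.wronskian_real (P.isRealSolution_two E) x
  have hw : (P.y1 E x * P.q2 E x - P.y2 E x * P.q1 E x : ℂ) = 1 := by
    exact_mod_cast P.wronskian E x
  simp only [y1_zero, y2_zero, q1_zero, q2_zero] at h1 h2
  push_cast at h1 h2
  linear_combination (-p x) * hw - P.q2 E x * h1 + P.q1 E x * h2

/-- The flux of a solution is determined by the solution. -/
lemma IsSolution.flux_unique {E : ℝ} {ψ p q : ℝ → ℂ} (h : P.IsSolution E ψ p)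
    (h' : P.IsSolution E ψ q) : p = q := by
  refine Continuous.ext_on (P.countable_singularSet.dense_compl ℝ) h.continuous_flux
    h'.continuous_flux fun x hx => ?_
  have hr := regular_of_notMem hx
  -- Off the countable singular set both fluxes are ψ' / μ; density and continuity extend the
  -- equality.
  have := (h.hasDerivAt_fun x hr.1 hr.2).unique (h'.hasDerivAt_fun x hr.1 hr.2)
  exact mul_left_cancel₀ (by exact_mod_cast (P.μ_pos x).ne') this

variable (P)

lemma isSolution_combination (E : ℝ) (α β : ℂ) :
    P.IsSolution E (fun x => α * P.y1 E x + β * P.y2 E x)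
      (fun x => α * P.q1 E x + β * P.q2 E x) where
  continuous_fun := by fun_prop
  continuous_flux := by fun_prop
  hasDerivAt_fun x h1 h2 := by
    have hx : x ∉ P.singularSet := fun h => h ⟨h1, h2⟩
    refine ((((P.isRealSolution_one E).hasDerivAt_fun x hx).ofReal_comp.const_mul α).add
      (((P.isRealSolution_two E).hasDerivAt_fun x hx).ofReal_comp.const_mul β)).congr_deriv ?_
    push_cast; ring
  hasDerivAt_flux x h1 h2 := by
    have hx : x ∉ P.singularSet := fun h => h ⟨h1, h2⟩
    refine ((((P.isRealSolution_one E).hasDerivAt_flux x hx).ofReal_comp.const_mul α).add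
      (((P.isRealSolution_two E).hasDerivAt_flux x hx).ofReal_comp.const_mul β)).congr_deriv ?_
    push_cast; ring

/-- Choice returns some solution with the given data, and `IsSolution.eq_fun` leaves only one. -/
lemma initialValueSolution_eq (E : ℝ) (a b : ℂ) :
    P.initialValueSolution E a b = fun x => a * P.y1 E x + b * P.y2 E x := by
  have : ∃ ψ : ℝ → ℂ, ∃ p, P.IsSolution E ψ p ∧ ψ 0 = a ∧ p 0 = b :=
    ⟨_, _, P.isSolution_combination E a b, by simp, by simp⟩
  obtain ⟨p, hp, h0, h1⟩ := Classical.epsilon_spec this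
  funext x
  have := hp.eq_fun x
  rw [h0, h1] at this
  exact this

lemma psi1_eq (E : ℝ) : P.psi1 E = fun x => (P.y1 E x : ℂ) := by
  simp [psi1, initialValueSolution_eq]

lemma psi2_eq (E : ℝ) : P.psi2 E = fun x => (P.y2 E x : ℂ) := by
  simp [psi2, initialValueSolution_eq]

variable {P}

lemma IsSolution.shift {E : ℝ} {ψ p : ℝ → ℂ} (h : P.IsSolution E ψ p) :
    P.IsSolution E (fun x => ψ (x + 1)) (fun x => p (x + 1)) where
  continuous_fun := h.continuous_fun.comp (by fun_prop)
  continuous_flux := h.continuous_flux.comp (by fun_prop)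
  hasDerivAt_fun x h1 h2 := by
    have e1 : ContinuousAt P.ε (x + 1) := by
      have : P.ε = fun y => P.ε (y - 1) := funext fun y => by
        conv_lhs => rw [← sub_add_cancel y 1, P.ε_periodic]
      rw [this]
      exact ContinuousAt.comp (g := P.ε) (by simpa using h1) (by fun_prop)
    have e2 : ContinuousAt P.μ (x + 1) := by
      have : P.μ = fun y => P.μ (y - 1) := funext fun y => by
        conv_lhs => rw [← sub_add_cancel y 1, P.μ_periodic]
      rw [this]
      exact ContinuousAt.comp (g := P.μ) (by simpa using h2) (by fun_prop)
    have := (h.hasDerivAt_fun (x + 1) e1 e2).comp_add_const x 1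
    rwa [P.μ_periodic] at this
  hasDerivAt_flux x h1 h2 := by
    have e1 : ContinuousAt P.ε (x + 1) := by
      have : P.ε = fun y => P.ε (y - 1) := funext fun y => by
        conv_lhs => rw [← sub_add_cancel y 1, P.ε_periodic]
      rw [this]
      exact ContinuousAt.comp (g := P.ε) (by simpa using h1) (by fun_prop)
    have e2 : ContinuousAt P.μ (x + 1) := by
      have : P.μ = fun y => P.μ (y - 1) := funext fun y => by
        conv_lhs => rw [← sub_add_cancel y 1, P.μ_periodic]
      rw [this]
      exact ContinuousAt.comp (g := P.μ) (by simpa using h2) (by fun_prop)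
    have := (h.hasDerivAt_flux (x + 1) e1 e2).comp_add_const x 1
    rwa [P.ε_periodic] at this

variable (P)

lemma isSolution_y1 (E : ℝ) :
    P.IsSolution E (fun x => (P.y1 E x : ℂ)) (fun x => (P.q1 E x : ℂ)) := by
  simpa using P.isSolution_combination E 1 0

lemma isSolution_y2 (E : ℝ) :
    P.IsSolution E (fun x => (P.y2 E x : ℂ)) (fun x => (P.q2 E x : ℂ)) := by
  simpa using P.isSolution_combination E 0 1

/-- Translation by a period preserves solutions, so the translate expands in `y1`, `y2` with
monodromy entries as coefficients. -/
lemma y1_add_one (E x : ℝ) :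
    P.y1 E (x + 1) = P.y1 E 1 * P.y1 E x + P.q1 E 1 * P.y2 E x := by
  have := (P.isSolution_y1 E).shift.eq_fun x
  rw [zero_add] at this; exact_mod_cast this

lemma y2_add_one (E x : ℝ) :
    P.y2 E (x + 1) = P.y2 E 1 * P.y1 E x + P.q2 E 1 * P.y2 E x := by
  have := (P.isSolution_y2 E).shift.eq_fun x
  rw [zero_add] at this; exact_mod_cast this

lemma q2_add_one (E x : ℝ) :
    P.q2 E (x + 1) = P.y2 E 1 * P.q1 E x + P.q2 E 1 * P.q2 E x := by
  have := (P.isSolution_y2 E).shift.eq_flux x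
  rw [zero_add] at this; exact_mod_cast this

section Even

variable {P} (hε : ∀ x, P.ε (-x) = P.ε x) (hμ : ∀ x, P.μ (-x) = P.μ x)

include hε hμ

lemma y1_neg (E x : ℝ) : P.y1 E (-x) = P.y1 E x := by simp [y1, primitiveSeries_neg _ hμ hε]

lemma y2_neg (E x : ℝ) : P.y2 E (-x) = -P.y2 E x := by simp [y2, primitiveSeries_neg _ hμ hε]

lemma q1_neg (E x : ℝ) : P.q1 E (-x) = -P.q1 E x := by simp [q1, primitiveSeries_neg _ hε hμ]

lemma q2_neg (E x : ℝ) : P.q2 E (-x) = P.q2 E x := by simp [q2, primitiveSeries_neg _ hε hμ]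

/-- By parity, translating from -1 to 0 inverts the monodromy matrix. With d = `q2 E 1` this and the
Wronskian give a(a - d) = b(a - d) = 0; if a ≠ d then a = b = 0, against determinant 1. -/
lemma q2_one (E : ℝ) : P.q2 E 1 = P.y1 E 1 := by
  have h1 := P.y1_add_one E (-1)
  have h2 := P.y2_add_one E (-1)
  have h4 := P.q2_add_one E (-1)
  have hw := P.wronskian E 1
  simp only [neg_add_cancel, y1_zero, y2_zero, q2_zero, y1_neg hε hμ, y2_neg hε hμ,
    q1_neg hε hμ, q2_neg hε hμ] at h1 h2 h4
  generalize P.y1 E 1 = a at *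
  generalize P.y2 E 1 = b at *
  generalize P.q1 E 1 = c at *
  generalize P.q2 E 1 = d at *
  by_contra hne
  have hne' : a - d ≠ 0 := sub_ne_zero.2 (Ne.symm hne)
  have ha : a = 0 := by
    have : a * (a - d) = 0 := by linarith
    exact (mul_eq_zero.1 this).resolve_right hne'
  have hb : b = 0 := by
    have : b * (a - d) = 0 := by linarith
    exact (mul_eq_zero.1 this).resolve_right hne'
  subst ha hb
  simp at hw

lemma det_monodromy (E : ℝ) : P.y1 E 1 ^ 2 - P.y2 E 1 * P.q1 E 1 = 1 := by
  have hw := P.wronskian E 1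
  rw [q2_one hε hμ] at hw
  linarith

end Even

lemma one_lt_y1_one_of_neg {E : ℝ} (hE : E < 0) : 1 < P.y1 E 1 :=
  one_lt_primitiveSeries_zero P.isCoefficient_μ P.isCoefficient_ε P.μ_pos P.ε_pos hE one_pos

end PhotonicStructure

/-! ### Differentiation in the energy -/

/-- Carathéodory's criterion for differentiability. -/
lemma hasDerivAt_of_eq_add_mul {f h : ℝ → ℝ} {e : ℝ} (hf : ∀ x, f x = f e + (x - e) * h x)
    (hh : ContinuousAt h e) : HasDerivAt f (h e) e := by
  rw [hasDerivAt_iff_tendsto_slope]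
  refine (hh.tendsto.mono_left nhdsWithin_le_nhds).congr' ?_
  filter_upwards [self_mem_nhdsWithin] with x hx
  have : x - e ≠ 0 := sub_ne_zero.2 hx
  rw [slope_def_field, hf x]
  field_simp
  ring

namespace PhotonicStructure

variable (P : PhotonicStructure)

/-- The weighted integral `∫₀ˣ ε f(E₀) g(E)` of two energy-dependent functions. -/
noncomputable def crossIntegral (f g : ℝ → ℝ → ℝ) (E₀ E x : ℝ) : ℝ :=
  ∫ t in (0 : ℝ)..x, P.ε t * (f E₀ t * g E t)

lemma continuous_crossIntegral {f g : ℝ → ℝ → ℝ} (hf : Continuous fun p : ℝ × ℝ => f p.1 p.2)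
    (hg : Continuous fun p : ℝ × ℝ => g p.1 p.2) :
    Continuous fun p : (ℝ × ℝ) × ℝ => P.crossIntegral f g p.1.1 p.1.2 p.2 := by
  refine P.isCoefficient_ε.continuous_parametric_primitive
    (F := fun (e : ℝ × ℝ) t => f e.1 t * g e.2 t) ?_
  exact (hf.comp (g := fun p : ℝ × ℝ => f p.1 p.2) (f := fun p : (ℝ × ℝ) × ℝ => (p.1.1, p.2))
    (by fun_prop)).mul (hg.comp (g := fun p : ℝ × ℝ => g p.1 p.2)
      (f := fun p : (ℝ × ℝ) × ℝ => (p.1.2, p.2)) (by fun_prop))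

@[fun_prop]
lemma continuous_cross {X : Type*} [TopologicalSpace X] {f g : ℝ → ℝ → ℝ} {u v w : X → ℝ}
    (hf : Continuous fun p : ℝ × ℝ => f p.1 p.2)
    (hg : Continuous fun p : ℝ × ℝ => g p.1 p.2) (hu : Continuous u) (hv : Continuous v)
    (hw : Continuous w) : Continuous fun x => P.crossIntegral f g (u x) (v x) (w x) :=
  (P.continuous_crossIntegral hf hg).comp ((hu.prodMk hv).prodMk hw)

/-- The difference quotient of `y1` in the energy. -/
noncomputable def slopeY1 (E₀ E x : ℝ) : ℝ :=
  P.y1 E₀ x * P.crossIntegral P.y2 P.y1 E₀ E x - P.y2 E₀ x * P.crossIntegral P.y1 P.y1 E₀ E x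

/-- The difference quotient of `y2` in the energy. -/
noncomputable def slopeY2 (E₀ E x : ℝ) : ℝ :=
  P.y1 E₀ x * P.crossIntegral P.y2 P.y2 E₀ E x - P.y2 E₀ x * P.crossIntegral P.y1 P.y2 E₀ E x

/-- The difference quotient of `q1` in the energy. -/
noncomputable def slopeQ1 (E₀ E x : ℝ) : ℝ :=
  P.q1 E₀ x * P.crossIntegral P.y2 P.y1 E₀ E x - P.q2 E₀ x * P.crossIntegral P.y1 P.y1 E₀ E x

/-- The difference quotient of `q2` in the energy. -/
noncomputable def slopeQ2 (E₀ E x : ℝ) : ℝ :=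
  P.q1 E₀ x * P.crossIntegral P.y2 P.y2 E₀ E x - P.q2 E₀ x * P.crossIntegral P.y1 P.y2 E₀ E x

lemma lagrange_relations (E₀ E x : ℝ) :
    (P.y1 E₀ x * P.q1 E x - P.y1 E x * P.q1 E₀ x =
        (E₀ - E) * P.crossIntegral P.y1 P.y1 E₀ E x) ∧
    (P.y2 E₀ x * P.q1 E x - P.y1 E x * P.q2 E₀ x =
        -1 + (E₀ - E) * P.crossIntegral P.y2 P.y1 E₀ E x) ∧
    (P.y1 E₀ x * P.q2 E x - P.y2 E x * P.q1 E₀ x =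
        1 + (E₀ - E) * P.crossIntegral P.y1 P.y2 E₀ E x) ∧
    (P.y2 E₀ x * P.q2 E x - P.y2 E x * P.q2 E₀ x =
        (E₀ - E) * P.crossIntegral P.y2 P.y2 E₀ E x) := by
  unfold crossIntegral
  refine ⟨?_, ?_, ?_, ?_⟩
  · simpa using (P.isRealSolution_one E₀).lagrange (P.isRealSolution_one E) x
  · simpa using (P.isRealSolution_two E₀).lagrange (P.isRealSolution_one E) x
  · simpa using (P.isRealSolution_one E₀).lagrange (P.isRealSolution_two E) x
  · simpa using (P.isRealSolution_two E₀).lagrange (P.isRealSolution_two E) x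

/-- Variation of constants in exact form: the Lagrange identities for the energies E₀ and E are
solved by Cramer's rule. The quotient is jointly continuous, so Carathéodory's criterion gives the
derivative directly. -/
lemma y1_eq_add_slope (E₀ E x : ℝ) :
    P.y1 E x = P.y1 E₀ x + (E - E₀) * P.slopeY1 E₀ E x := by
  obtain ⟨h1, h2, -, -⟩ := P.lagrange_relations E₀ E x
  rw [slopeY1]
  linear_combination (-P.y1 E x) * P.wronskian E₀ x + P.y2 E₀ x * h1 - P.y1 E₀ x * h2

lemma y2_eq_add_slope (E₀ E x : ℝ) :
    P.y2 E x = P.y2 E₀ x + (E - E₀) * P.slopeY2 E₀ E x := by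
  obtain ⟨-, -, h1, h2⟩ := P.lagrange_relations E₀ E x
  rw [slopeY2]
  linear_combination (-P.y2 E x) * P.wronskian E₀ x + P.y2 E₀ x * h1 - P.y1 E₀ x * h2

lemma q1_eq_add_slope (E₀ E x : ℝ) :
    P.q1 E x = P.q1 E₀ x + (E - E₀) * P.slopeQ1 E₀ E x := by
  obtain ⟨h1, h2, -, -⟩ := P.lagrange_relations E₀ E x
  rw [slopeQ1]
  linear_combination (-P.q1 E x) * P.wronskian E₀ x + P.q2 E₀ x * h1 - P.q1 E₀ x * h2

lemma q2_eq_add_slope (E₀ E x : ℝ) :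
    P.q2 E x = P.q2 E₀ x + (E - E₀) * P.slopeQ2 E₀ E x := by
  obtain ⟨-, -, h1, h2⟩ := P.lagrange_relations E₀ E x
  rw [slopeQ2]
  linear_combination (-P.q2 E x) * P.wronskian E₀ x + P.q2 E₀ x * h1 - P.q1 E₀ x * h2

@[fun_prop]
lemma continuous_slopeY1 {X : Type*} [TopologicalSpace X] {u v w : X → ℝ} (hu : Continuous u)
    (hv : Continuous v) (hw : Continuous w) :
    Continuous fun x => P.slopeY1 (u x) (v x) (w x) := by
  unfold slopeY1; fun_prop

@[fun_prop]
lemma continuous_slopeY2 {X : Type*} [TopologicalSpace X] {u v w : X → ℝ} (hu : Continuous u)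
    (hv : Continuous v) (hw : Continuous w) :
    Continuous fun x => P.slopeY2 (u x) (v x) (w x) := by
  unfold slopeY2; fun_prop

@[fun_prop]
lemma continuous_slopeQ1 {X : Type*} [TopologicalSpace X] {u v w : X → ℝ} (hu : Continuous u)
    (hv : Continuous v) (hw : Continuous w) :
    Continuous fun x => P.slopeQ1 (u x) (v x) (w x) := by
  unfold slopeQ1; fun_prop

@[fun_prop]
lemma continuous_slopeQ2 {X : Type*} [TopologicalSpace X] {u v w : X → ℝ} (hu : Continuous u)
    (hv : Continuous v) (hw : Continuous w) :
    Continuous fun x => P.slopeQ2 (u x) (v x) (w x) := by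
  unfold slopeQ2; fun_prop

lemma hasDerivAt_y1 (E x : ℝ) : HasDerivAt (fun e => P.y1 e x) (P.slopeY1 E E x) E :=
  hasDerivAt_of_eq_add_mul (h := fun e => P.slopeY1 E e x) (fun e => P.y1_eq_add_slope E e x)
    (Continuous.continuousAt (by fun_prop))

lemma hasDerivAt_y2 (E x : ℝ) : HasDerivAt (fun e => P.y2 e x) (P.slopeY2 E E x) E :=
  hasDerivAt_of_eq_add_mul (h := fun e => P.slopeY2 E e x) (fun e => P.y2_eq_add_slope E e x)
    (Continuous.continuousAt (by fun_prop))

lemma hasDerivAt_q2 (E x : ℝ) : HasDerivAt (fun e => P.q2 e x) (P.slopeQ2 E E x) E :=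
  hasDerivAt_of_eq_add_mul (h := fun e => P.slopeQ2 E e x) (fun e => P.q2_eq_add_slope E e x)
    (Continuous.continuousAt (by fun_prop))

/-- The square of the norm of `y1`. -/
noncomputable def normSq1 (E : ℝ) : ℝ := P.crossIntegral P.y1 P.y1 E E 1

/-- The square of the norm of `y2`. -/
noncomputable def normSq2 (E : ℝ) : ℝ := P.crossIntegral P.y2 P.y2 E E 1

@[fun_prop]
lemma continuous_normSq1 : Continuous P.normSq1 := by unfold normSq1; fun_prop

@[fun_prop]
lemma continuous_normSq2 : Continuous P.normSq2 := by unfold normSq2; fun_prop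

/-- Derivative in the energy of a weighted square norm. -/
lemma hasDerivAt_crossIntegral_self {f : ℝ → ℝ → ℝ} {s : ℝ → ℝ → ℝ → ℝ}
    (hf : Continuous fun p : ℝ × ℝ => f p.1 p.2)
    (hs : Continuous fun p : (ℝ × ℝ) × ℝ => s p.1.1 p.1.2 p.2)
    (hfs : ∀ E₀ E x, f E x = f E₀ x + (E - E₀) * s E₀ E x) (E : ℝ) :
    HasDerivAt (fun e => P.crossIntegral f f e e 1)
      (2 * ∫ t in (0 : ℝ)..1, P.ε t * (f E t * s E E t)) E := by
  have hfu : ∀ e, Continuous (f e) := fun e => hf.comp (Continuous.prodMk_right e)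
  have hsu : ∀ e, Continuous (s E e) := fun e => hs.comp (Continuous.prodMk_right (E, e))
  have hcont : Continuous fun e => ∫ t in (0 : ℝ)..1, P.ε t * (s E e t * (f e t + f E t)) := by
    refine (P.isCoefficient_ε.continuous_parametric_primitive
      (F := fun (e t : ℝ) => s E e t * (f e t + f E t)) ?_).comp
      (Continuous.prodMk_left (1 : ℝ))
    exact (hs.comp (f := fun p : ℝ × ℝ => ((E, p.1), p.2)) (by fun_prop)).mul
      (hf.add ((hfu E).comp continuous_snd))
  -- A difference of squares factors as f(e)² - f(E)² = (e - E) s (f(e) + f(E)), which gives the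
  -- quotient of the integrals.
  have key := hasDerivAt_of_eq_add_mul (f := fun e => P.crossIntegral f f e e 1)
    (h := fun e => ∫ t in (0 : ℝ)..1, P.ε t * (s E e t * (f e t + f E t))) (e := E) ?_
    hcont.continuousAt
  · refine key.congr_deriv ?_
    rw [← intervalIntegral.integral_const_mul]
    refine intervalIntegral.integral_congr fun t _ => ?_
    ring
  · intro e
    have i1 := P.isCoefficient_ε.intervalIntegrable_mul (h := fun t => f E t * f E t)
      ((hfu E).mul (hfu E)) 0 1
    have i2 := P.isCoefficient_ε.intervalIntegrable_mul
      (h := fun t => s E e t * (f e t + f E t)) ((hsu e).mul ((hfu e).add (hfu E))) 0 1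
    simp only [crossIntegral]
    rw [← intervalIntegral.integral_const_mul, ← intervalIntegral.integral_add i1 (i2.const_mul _)]
    refine intervalIntegral.integral_congr fun t _ => ?_
    linear_combination (P.ε t * (f e t + f E t)) * hfs E e t

lemma hasDerivAt_normSq1 (E : ℝ) : HasDerivAt P.normSq1
    (2 * ∫ t in (0 : ℝ)..1, P.ε t * (P.y1 E t * P.slopeY1 E E t)) E :=
  P.hasDerivAt_crossIntegral_self P.continuous_y1 (by fun_prop) P.y1_eq_add_slope E

lemma hasDerivAt_normSq2 (E : ℝ) : HasDerivAt P.normSq2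
    (2 * ∫ t in (0 : ℝ)..1, P.ε t * (P.y2 E t * P.slopeY2 E E t)) E :=
  P.hasDerivAt_crossIntegral_self P.continuous_y2 (by fun_prop) P.y2_eq_add_slope E

variable {P}

lemma integral_sq_pos {f : ℝ → ℝ} (hf : Continuous f) {x : ℝ} (hx : x ∈ Ioo (0 : ℝ) 1)
    (hfx : f x ≠ 0) : 0 < ∫ t in (0 : ℝ)..1, P.ε t * (f t * f t) := by
  have hU : {y | f y ≠ 0} ∩ Ioo 0 1 ∈ 𝓝 x :=
    inter_mem ((isOpen_ne_fun hf continuous_const).mem_nhds hfx) (isOpen_Ioo.mem_nhds hx)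
  obtain ⟨δ, hδ, hball⟩ := Metric.mem_nhds_iff.1 hU
  have hsub : ∀ y ∈ Ioo (x - δ) (x + δ), f y ≠ 0 ∧ 0 < y ∧ y < 1 := fun y hy =>
    hball (by rwa [Real.ball_eq_Ioo])
  have hin := P.isCoefficient_ε.intervalIntegrable_mul (hf.mul hf)
  have hpos : 0 < ∫ t in (x - δ / 2)..(x + δ / 2), P.ε t * (f t * f t) :=
    intervalIntegral.intervalIntegral_pos_of_pos_on (hin _ _)
      (fun y hy => mul_pos (P.ε_pos y) (mul_self_pos.2
        (hsub y ⟨by linarith [hy.1], by linarith [hy.2]⟩).1)) (by linarith)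
  refine hpos.trans_le (intervalIntegral.integral_mono_interval ?_ (by linarith) ?_
    (Eventually.of_forall fun y => mul_nonneg (P.ε_pos y).le (mul_self_nonneg _)) (hin _ _))
  · exact (hsub _ ⟨by linarith, by linarith⟩).2.1.le
  · exact (hsub _ ⟨by linarith, by linarith⟩).2.2.le

/-- A nontrivial real solution has positive norm. -/
lemma IsRealSolution.integral_sq_pos {E : ℝ} {f q : ℝ → ℝ} (h : P.IsRealSolution E f q)
    (h0 : f 0 ≠ 0 ∨ q 0 ≠ 0) : 0 < ∫ t in (0 : ℝ)..1, P.ε t * (f t * f t) := by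
  by_cases hz : ∃ x ∈ Ioo (0 : ℝ) 1, f x ≠ 0
  · obtain ⟨x, hx, hfx⟩ := hz
    exact PhotonicStructure.integral_sq_pos h.continuous_fun hx hfx
  -- If f vanishes on (0, 1), then so does the flux f' / μ off a countable set, and by continuity
  -- both initial data are zero.
  push Not at hz
  exfalso
  have hmem : (0 : ℝ) ∈ closure (Ioo (0 : ℝ) 1) := by
    rw [closure_Ioo zero_ne_one]; exact ⟨le_rfl, zero_le_one⟩
  have hf0 : f 0 = 0 :=
    closure_minimal (t := {x | f x = 0}) (fun x hx => hz x hx)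
      (isClosed_eq h.continuous_fun continuous_const) hmem
  have hq0 : q 0 = 0 := by
    have hd := P.countable_singularSet.dense_compl ℝ
    have h1 : Ioo (0 : ℝ) 1 ⊆ closure (Ioo 0 1 ∩ P.singularSetᶜ) :=
      hd.open_subset_closure_inter isOpen_Ioo
    refine closure_minimal (t := {x | q x = 0}) ?_
      (isClosed_eq h.continuous_flux continuous_const)
      (closure_minimal h1 isClosed_closure hmem)
    rintro x ⟨hx, hxs⟩
    have hloc : f =ᶠ[𝓝 x] fun _ => 0 := by
      filter_upwards [isOpen_Ioo.mem_nhds hx] with y hy using hz y hy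
    have := (h.hasDerivAt_fun x hxs).unique
      ((hasDerivAt_const x (0 : ℝ)).congr_of_eventuallyEq hloc)
    exact (mul_eq_zero.1 this).resolve_left (P.μ_pos x).ne'
  rcases h0 with h0 | h0
  · exact h0 hf0
  · exact h0 hq0

variable (P)

lemma normSq1_pos (E : ℝ) : 0 < P.normSq1 E :=
  (P.isRealSolution_one E).integral_sq_pos (Or.inl (by simp))

lemma normSq2_pos (E : ℝ) : 0 < P.normSq2 E :=
  (P.isRealSolution_two E).integral_sq_pos (Or.inr (by simp))

section Even

variable {P} (hε : ∀ x, P.ε (-x) = P.ε x) (hμ : ∀ x, P.μ (-x) = P.μ x)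

include hε hμ

/-- Derivative of half the discriminant. -/
lemma two_mul_slopeY1_one (E : ℝ) :
    2 * P.slopeY1 E E 1 = P.q1 E 1 * P.normSq2 E - P.y2 E 1 * P.normSq1 E := by
  -- Both quantities are a'(E), because a = `q2 E 1` for all E. Adding their two formulas cancels
  -- the mixed integral of y1 y2.
  have h1 : P.slopeY1 E E 1 = P.slopeQ2 E E 1 := by
    refine (P.hasDerivAt_y1 E 1).unique ?_
    have := P.hasDerivAt_q2 E 1
    simpa only [q2_one hε hμ] using this
  have hsymm : P.crossIntegral P.y2 P.y1 E E 1 = P.crossIntegral P.y1 P.y2 E E 1 := by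
    refine intervalIntegral.integral_congr fun t _ => ?_
    ring
  have h2 : P.slopeY1 E E 1 = P.y1 E 1 * P.crossIntegral P.y1 P.y2 E E 1
      - P.y2 E 1 * P.normSq1 E := by rw [slopeY1, hsymm, normSq1]
  have h3 : P.slopeQ2 E E 1 = P.q1 E 1 * P.normSq2 E
      - P.y1 E 1 * P.crossIntegral P.y1 P.y2 E E 1 := by rw [slopeQ2, q2_one hε hμ, normSq2]
  linarith

/-- Half the discriminant is strictly monotone where it lies in `[-1, 1]`, except at points of
multiplicity two. -/
lemma slopeY1_one_ne_zero {E : ℝ} (h : P.y1 E 1 ^ 2 ≤ 1) (h0 : P.y2 E 1 ≠ 0 ∨ P.q1 E 1 ≠ 0) :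
    P.slopeY1 E E 1 ≠ 0 := by
  intro hs
  have h2 := two_mul_slopeY1_one hε hμ E
  have hd := det_monodromy hε hμ E
  have p1 := P.normSq1_pos E
  have p2 := P.normSq2_pos E
  rw [hs, mul_zero] at h2
  generalize P.y2 E 1 = b at *
  generalize P.q1 E 1 = c at *
  -- Since bc = a² - 1 ≤ 0, the balance c ‖y2‖² = b ‖y1‖² is only possible with b = c = 0.
  have hbc : b * c ≤ 0 := by linarith
  have hb : b = 0 := by
    have : b * b * P.normSq1 E = b * c * P.normSq2 E := by linear_combination b * h2
    have h3 : b * b * P.normSq1 E ≤ 0 := this ▸ mul_nonpos_of_nonpos_of_nonneg hbc p2.le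
    exact mul_self_eq_zero.1 (le_antisymm (nonpos_of_mul_nonpos_left h3 p1) (mul_self_nonneg b))
  have hc : c = 0 := by
    rw [hb, zero_mul, sub_zero, eq_comm] at h2
    exact (mul_eq_zero.1 h2).resolve_right p2.ne'
  exact h0.elim (fun h => h hb) (fun h => h hc)

end Even

end PhotonicStructure

/-! ### Multiplicities of eigenvalues from the monodromy matrix -/

namespace PhotonicStructure

variable (P : PhotonicStructure)

/-- The linear map from initial data to solutions. -/
noncomputable def solutionMap (E : ℝ) : ℂ × ℂ →ₗ[ℂ] (ℝ → ℂ) where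
  toFun v := fun x => v.1 * P.y1 E x + v.2 * P.y2 E x
  map_add' v w := by funext x; simp only [Prod.fst_add, Prod.snd_add, Pi.add_apply]; ring
  map_smul' c v := by
    funext x
    simp only [Prod.smul_fst, Prod.smul_snd, Pi.smul_apply, smul_eq_mul, RingHom.id_apply]
    ring

lemma solutionMap_injective (E : ℝ) : Function.Injective (P.solutionMap E) := by
  intro v w h
  have hs : ∀ u : ℂ × ℂ, P.IsSolution E (P.solutionMap E u)
      (fun x => u.1 * P.q1 E x + u.2 * P.q2 E x) := fun u => P.isSolution_combination E u.1 u.2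
  have hp := (h ▸ hs v).flux_unique (hs w)
  refine Prod.ext ?_ ?_
  · have := congrFun h 0
    simpa [solutionMap] using this
  · have := congrFun hp 0
    simpa using this

/-- Initial data of Bloch modes: eigenvectors of the monodromy matrix. -/
def blochData (k E : ℝ) : Submodule ℂ (ℂ × ℂ) where
  carrier := {v | v.1 * P.y1 E 1 + v.2 * P.y2 E 1 = Complex.exp (Complex.I * k) * v.1 ∧
    v.1 * P.q1 E 1 + v.2 * P.q2 E 1 = Complex.exp (Complex.I * k) * v.2}
  zero_mem' := by simp
  add_mem' := by
    rintro v w ⟨h1, h2⟩ ⟨h3, h4⟩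
    refine ⟨?_, ?_⟩
    · simp only [Prod.fst_add, Prod.snd_add]; linear_combination h1 + h3
    · simp only [Prod.fst_add, Prod.snd_add]; linear_combination h2 + h4
  smul_mem' := by
    rintro c v ⟨h1, h2⟩
    refine ⟨?_, ?_⟩
    · simp only [Prod.smul_fst, Prod.smul_snd, smul_eq_mul]; linear_combination c * h1
    · simp only [Prod.smul_fst, Prod.smul_snd, smul_eq_mul]; linear_combination c * h2

/-- By uniqueness of solutions, quasi-periodicity for all x reduces to an eigenvector equation for
the initial data. The flux row follows since the flux is determined by the solution. -/
lemma blochSpace_eq_map (k E : ℝ) :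
    P.blochSpace k E = (P.blochData k E).map (P.solutionMap E) := by
  ext ψ
  constructor
  · rintro ⟨⟨p, hp⟩, hper⟩
    have hz : P.IsSolution E (fun x => ψ (x + 1)) (fun x => Complex.exp (Complex.I * k) * p x) := by
      rw [funext hper]
      refine ⟨continuous_const.mul hp.1, continuous_const.mul hp.2, fun x h1 h2 => ?_,
        fun x h1 h2 => ?_⟩
      · exact ((hp.3 x h1 h2).const_mul _).congr_deriv (by ring)
      · exact ((hp.4 x h1 h2).const_mul _).congr_deriv (by ring)
    have hflux := hp.shift.flux_unique hz
    refine ⟨(ψ 0, p 0), ⟨?_, ?_⟩, ?_⟩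
    · rw [← hp.eq_fun 1, ← hper 0, zero_add]
    · rw [← hp.eq_flux 1]
      have := congrFun hflux 0
      simpa using this
    · funext x
      exact (hp.eq_fun x).symm
  · rintro ⟨v, ⟨h1, h2⟩, rfl⟩
    have hs : P.IsSolution E (P.solutionMap E v)
      (fun x => v.1 * P.q1 E x + v.2 * P.q2 E x) := P.isSolution_combination E v.1 v.2
    refine ⟨⟨_, hs⟩, fun x => ?_⟩
    have := hs.shift.eq_fun x
    simp only [zero_add] at this
    rw [this, h2]
    have h0 : P.solutionMap E v 1 = Complex.exp (Complex.I * k) * v.1 := h1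
    rw [h0]
    simp only [solutionMap, LinearMap.coe_mk, AddHom.coe_mk]
    ring

lemma finrank_blochSpace (k E : ℝ) :
    Module.finrank ℂ (P.blochSpace k E) = Module.finrank ℂ (P.blochData k E) := by
  rw [blochSpace_eq_map]
  exact (Submodule.equivMapOfInjective _ (P.solutionMap_injective E) _).symm.finrank_eq

lemma finrank_blochSpace_le_two (k E : ℝ) : Module.finrank ℂ (P.blochSpace k E) ≤ 2 := by
  rw [finrank_blochSpace]
  exact (Submodule.finrank_le _).trans (by simp)

lemma exp_sq_add_one (k : ℝ) :
    Complex.exp (Complex.I * k) ^ 2 + 1 = 2 * Real.cos k * Complex.exp (Complex.I * k) := by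
  have h : Complex.exp (Complex.I * k) * Complex.exp (-(Complex.I * k)) = 1 := by
    rw [← Complex.exp_add]; simp
  have hc : (2 : ℂ) * Real.cos k =
      Complex.exp (Complex.I * k) + Complex.exp (-(Complex.I * k)) := by
    rw [Complex.ofReal_cos, Complex.two_cos, mul_comm Complex.I, ← neg_mul]
  rw [hc]; linear_combination -h

lemma exp_eq_cos_add (k : ℝ) :
    Complex.exp (Complex.I * k) = Real.cos k + Complex.I * Real.sin k := by
  rw [mul_comm, Complex.exp_mul_I, Complex.ofReal_cos, Complex.ofReal_sin, mul_comm Complex.I]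

section Even

variable {P} (hε : ∀ x, P.ε (-x) = P.ε x) (hμ : ∀ x, P.μ (-x) = P.μ x)

include hε hμ

/-- With z = e^{ik} the left side is the characteristic polynomial z² - 2az + 1 of the monodromy
matrix, and z² + 1 = 2z cos k. -/
lemma characteristic_identity (k E : ℝ) :
    ((P.y1 E 1 : ℂ) - Complex.exp (Complex.I * k)) ^ 2 - P.y2 E 1 * P.q1 E 1 =
      2 * Complex.exp (Complex.I * k) * (Real.cos k - P.y1 E 1) := by
  have hd : (P.y1 E 1 : ℂ) ^ 2 - P.y2 E 1 * P.q1 E 1 = 1 := by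
    exact_mod_cast det_monodromy hε hμ E
  linear_combination hd + exp_sq_add_one k

lemma finrank_pos_iff (k E : ℝ) :
    0 < Module.finrank ℂ (P.blochSpace k E) ↔ P.y1 E 1 = Real.cos k := by
  have hch := characteristic_identity hε hμ k E
  rw [finrank_blochSpace, Module.finrank_pos_iff, Submodule.nontrivial_iff_ne_bot]
  constructor
  · intro h
    obtain ⟨v, ⟨h1, h2⟩, hv⟩ := Submodule.exists_mem_ne_zero_of_ne_bot h
    rw [q2_one hε hμ] at h2
    have hne : (2 : ℂ) * Complex.exp (Complex.I * k) ≠ 0 :=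
      mul_ne_zero two_ne_zero (Complex.exp_ne_zero _)
    have h3 : (2 * Complex.exp (Complex.I * k) * (Real.cos k - P.y1 E 1)) * v.1 = 0 := by
      rw [← hch]
      linear_combination (P.y1 E 1 - Complex.exp (Complex.I * k)) * h1 - P.y2 E 1 * h2
    have h4 : (2 * Complex.exp (Complex.I * k) * (Real.cos k - P.y1 E 1)) * v.2 = 0 := by
      rw [← hch]
      linear_combination (P.y1 E 1 - Complex.exp (Complex.I * k)) * h2 - P.q1 E 1 * h1
    have h5 : (Real.cos k - P.y1 E 1 : ℂ) = 0 := by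
      by_contra hc
      exact hv (Prod.ext ((mul_eq_zero.1 h3).resolve_left (mul_ne_zero hne hc))
        ((mul_eq_zero.1 h4).resolve_left (mul_ne_zero hne hc)))
    have : (P.y1 E 1 : ℂ) = Real.cos k := (sub_eq_zero.1 h5).symm
    exact_mod_cast this
  · intro h hbot
    rw [h, sub_self, mul_zero, ← h] at hch
    have hz : ∀ v ∈ P.blochData k E, v = 0 := fun v hv => by
      rw [hbot] at hv; exact hv
    -- These two vectors are columns of the adjugate and lie in the kernel of M - z. If both vanish,
    -- M = z is scalar and (1, 0) is an eigenvector.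
    have e1 := hz (P.y2 E 1, Complex.exp (Complex.I * k) - P.y1 E 1)
      ⟨by simp only; ring, by simp only [q2_one hε hμ]; linear_combination -hch⟩
    have e2 := hz (Complex.exp (Complex.I * k) - P.y1 E 1, P.q1 E 1)
      ⟨by simp only; linear_combination -hch, by simp only [q2_one hε hμ]; ring⟩
    have b0 : (P.y2 E 1 : ℂ) = 0 := congrArg Prod.fst e1
    have z0 : Complex.exp (Complex.I * k) - (P.y1 E 1 : ℂ) = 0 := congrArg Prod.snd e1
    have e3 := hz (1, 0) ⟨by simp only; linear_combination -z0,
      by simp only [show (P.q1 E 1 : ℂ) = 0 from congrArg Prod.snd e2]; ring⟩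
    exact one_ne_zero (congrArg Prod.fst e3)

/-- Multiplicity two means that the monodromy matrix is scalar. -/
lemma two_le_finrank_iff (k E : ℝ) :
    2 ≤ Module.finrank ℂ (P.blochSpace k E) ↔
      P.y1 E 1 = Real.cos k ∧ P.y2 E 1 = 0 ∧ P.q1 E 1 = 0 := by
  constructor
  · intro h
    refine ⟨(finrank_pos_iff hε hμ k E).1 (by omega), ?_⟩
    rw [finrank_blochSpace] at h
    have htop : P.blochData k E = ⊤ := by
      apply Submodule.eq_top_of_finrank_eq
      refine le_antisymm (Submodule.finrank_le _) ?_
      simpa using h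
    have h1 : ((1, 0) : ℂ × ℂ) ∈ P.blochData k E := htop ▸ Submodule.mem_top
    have h2 : ((0, 1) : ℂ × ℂ) ∈ P.blochData k E := htop ▸ Submodule.mem_top
    constructor
    · have := h2.1; simpa using this
    · have := h1.2; simpa using this
  · rintro ⟨h, hb, hc⟩
    have hch := characteristic_identity hε hμ k E
    rw [h, sub_self, mul_zero, ← h, hb, Complex.ofReal_zero, zero_mul, sub_zero] at hch
    have hz : (P.y1 E 1 : ℂ) = Complex.exp (Complex.I * k) :=
      sub_eq_zero.1 (pow_eq_zero_iff two_ne_zero |>.1 hch)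
    have htop : P.blochData k E = ⊤ := by
      refine Submodule.eq_top_iff'.2 fun v => ⟨?_, ?_⟩
      · rw [hb, hz, Complex.ofReal_zero]; ring
      · rw [q2_one hε hμ, hc, hz, Complex.ofReal_zero]; ring
    rw [finrank_blochSpace, htop, finrank_top]
    simp

/-- Multiplicities are at most 2 and are characterized by conditions that involve k only through cos
k. -/
lemma eigenvalueCount_neg (k E : ℝ) : P.eigenvalueCount (-k) E = P.eigenvalueCount k E := by
  have hrank : ∀ e, Module.finrank ℂ (P.blochSpace (-k) e) =
      Module.finrank ℂ (P.blochSpace k e) := by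
    intro e
    have h1 := finrank_pos_iff hε hμ (-k) e
    have h2 := finrank_pos_iff hε hμ k e
    have h3 := two_le_finrank_iff hε hμ (-k) e
    have h4 := two_le_finrank_iff hε hμ k e
    have h5 := P.finrank_blochSpace_le_two (-k) e
    have h6 := P.finrank_blochSpace_le_two k e
    rw [Real.cos_neg] at h1 h3
    rw [← h2] at h1
    rw [← h4] at h3
    omega
  simp only [eigenvalueCount, hrank]

lemma dispersion_neg (j : ℕ) (k : ℝ) : P.dispersion j (-k) = P.dispersion j k := by
  simp only [dispersion, eigenvalueCount_neg hε hμ]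

lemma eigenvalueCount_of_neg (k : ℝ) {E : ℝ} (hE : E < 0) : P.eigenvalueCount k E = 0 := by
  rw [eigenvalueCount, Set.encard_eq_zero, Set.eq_empty_iff_forall_notMem]
  rintro ⟨e, m⟩ ⟨he, hm⟩
  have h := (finrank_pos_iff hε hμ k e).1 (by simp only at hm; omega)
  have := P.one_lt_y1_one_of_neg (E := e) (lt_of_le_of_lt he hE)
  linarith [Real.cos_le_one k]

lemma nonneg_of_le_eigenvalueCount {j : ℕ} (hj : 1 ≤ j) {k E : ℝ}
    (h : (j : ℕ∞) ≤ P.eigenvalueCount k E) : 0 ≤ E := by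
  by_contra hE
  rw [eigenvalueCount_of_neg hε hμ k (not_le.1 hE)] at h
  have : j = 0 := by simpa using h
  omega

end Even

lemma eigenvalueCount_mono (k : ℝ) : Monotone (P.eigenvalueCount k) := fun _ _ h =>
  Set.encard_le_encard fun _ hq => ⟨hq.1.trans h, hq.2⟩

end PhotonicStructure

/-! ### Persistence of eigenvalues in the wavenumber -/

namespace PhotonicStructure

variable {P : PhotonicStructure} (hε : ∀ x, P.ε (-x) = P.ε x) (hμ : ∀ x, P.μ (-x) = P.μ x)

include hε hμ

lemma abs_y1_one_lt_one_near_double {e : ℝ} (hb : P.y2 e 1 = 0) (hc : P.q1 e 1 = 0) :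
    ∀ᶠ x in 𝓝 e, x ≠ e → P.y1 x 1 ^ 2 < 1 := by
  have ha : P.y1 e 1 ^ 2 = 1 := by
    have := det_monodromy hε hμ e
    rw [hb] at this; linarith
  -- Both b and c vanish at e with slopes of opposite sign, so a² - 1 = bc is negative on both sides
  -- of e.
  have hslope : P.slopeY2 e e 1 * P.slopeQ1 e e 1 < 0 := by
    have h2 : P.slopeY2 e e 1 = P.y1 e 1 * P.normSq2 e := by
      rw [slopeY2, hb, zero_mul, sub_zero, normSq2]
    have h1 : P.slopeQ1 e e 1 = -(P.y1 e 1 * P.normSq1 e) := by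
      rw [slopeQ1, hc, zero_mul, zero_sub, normSq1, q2_one hε hμ]
    have : P.slopeY2 e e 1 * P.slopeQ1 e e 1 =
        -(P.y1 e 1 ^ 2 * (P.normSq1 e * P.normSq2 e)) := by
      rw [h1, h2]; ring
    rw [this, ha, one_mul]
    exact neg_neg_of_pos (mul_pos (P.normSq1_pos e) (P.normSq2_pos e))
  have hcont : Continuous fun x => P.slopeY2 e x 1 * P.slopeQ1 e x 1 := by fun_prop
  filter_upwards [hcont.continuousAt.eventually (gt_mem_nhds hslope)] with x hx hne
  have h1 := P.y2_eq_add_slope e x 1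
  have h2 := P.q1_eq_add_slope e x 1
  have hd := det_monodromy hε hμ x
  rw [hb, zero_add] at h1
  rw [hc, zero_add] at h2
  have : P.y2 x 1 * P.q1 x 1 = (x - e) ^ 2 * (P.slopeY2 e x 1 * P.slopeQ1 e x 1) := by
    rw [h1, h2]; ring
  have : P.y2 x 1 * P.q1 x 1 < 0 := by
    rw [this]
    exact mul_neg_of_pos_of_neg (by have := sub_ne_zero.2 hne; positivity) hx
  linarith

omit hε hμ in
/-- Near a crossing, half the discriminant takes values on both sides. -/
lemma exists_crossing {e : ℝ} (hs : P.slopeY1 e e 1 ≠ 0) {δ : ℝ} (hδ : 0 < δ) :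
    ∃ l r, e - δ < l ∧ l < r ∧ r < e + δ ∧
      (P.y1 l 1 - P.y1 e 1) * (P.y1 r 1 - P.y1 e 1) < 0 := by
  have hcont : Continuous fun x => P.slopeY1 e x 1 * P.slopeY1 e e 1 := by fun_prop
  have hpos : 0 < P.slopeY1 e e 1 * P.slopeY1 e e 1 := mul_self_pos.2 hs
  obtain ⟨η, hη, hball⟩ :=
    Metric.eventually_nhds_iff.1 (hcont.continuousAt.eventually (lt_mem_nhds hpos))
  set d := min δ η / 2 with hd
  have hd0 : 0 < d := by positivity
  have hdδ : d < δ := by have := min_le_left δ η; linarith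
  have hdη : d < η := by have := min_le_right δ η; linarith
  have hl := hball (y := e - d) (by rw [Real.dist_eq, abs_lt]; constructor <;> linarith)
  have hr := hball (y := e + d) (by rw [Real.dist_eq, abs_lt]; constructor <;> linarith)
  refine ⟨e - d, e + d, by linarith, by linarith, by linarith, ?_⟩
  rw [P.y1_eq_add_slope e (e - d) 1, P.y1_eq_add_slope e (e + d) 1]
  have h1 : 0 < (P.slopeY1 e (e - d) 1 * P.slopeY1 e (e + d) 1) := by
    have := mul_pos hl hr
    by_contra hneg
    nlinarith
  have : (P.y1 e 1 + (e - d - e) * P.slopeY1 e (e - d) 1 - P.y1 e 1) *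
      (P.y1 e 1 + (e + d - e) * P.slopeY1 e (e + d) 1 - P.y1 e 1) =
      -(d ^ 2 * (P.slopeY1 e (e - d) 1 * P.slopeY1 e (e + d) 1)) := by ring
  rw [this]
  exact neg_neg_of_pos (by positivity)

/-- Lower semicontinuity of the multiplicity. At a simple eigenvalue a crosses cos k₀ transversally.
At a double one it touches ±1 from inside, so each side of e supplies a solution of a = cos k by the
intermediate value theorem. -/
lemma finrank_le_encard_near (k₀ e : ℝ) {c d : ℝ} (hc : c < e) (hd : e < d) :
    ∀ᶠ k in 𝓝 k₀, (Module.finrank ℂ (P.blochSpace k₀ e) : ℕ∞) ≤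
      Set.encard {q : ℝ × ℕ | q.1 ∈ Ioo c d ∧ q.2 < Module.finrank ℂ (P.blochSpace k q.1)} := by
  have hcosc : Continuous Real.cos := Real.continuous_cos
  have hy : Continuous fun x => P.y1 x 1 := by fun_prop
  have hle2 := P.finrank_blochSpace_le_two k₀ e
  have hpos := finrank_pos_iff hε hμ k₀ e
  have htwo := two_le_finrank_iff hε hμ k₀ e
  rcases Nat.eq_zero_or_pos (Module.finrank ℂ (P.blochSpace k₀ e)) with h0 | h0
  · exact Eventually.of_forall fun k => by simp [h0]
  have hek := hpos.1 h0
  set δ := min (e - c) (d - e)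
  have hδ : 0 < δ := lt_min (by linarith) (by linarith)
  have hδc : c ≤ e - δ := by linarith [min_le_left (e - c) (d - e)]
  have hδd : e + δ ≤ d := by linarith [min_le_right (e - c) (d - e)]
  by_cases h2 : 2 ≤ Module.finrank ℂ (P.blochSpace k₀ e)
  · obtain ⟨-, hb, hq⟩ := htwo.1 h2
    have hrank : Module.finrank ℂ (P.blochSpace k₀ e) = 2 := le_antisymm hle2 h2
    have ha : P.y1 e 1 ^ 2 = 1 := by
      have := det_monodromy hε hμ e
      rw [hb] at this; linarith
    obtain ⟨η, hη, hball⟩ :=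
      Metric.eventually_nhds_iff.1 (abs_y1_one_lt_one_near_double hε hμ hb hq)
    set t := min δ η / 2 with ht
    have ht0 : 0 < t := by positivity
    have htδ : t < δ := by have := min_le_left δ η; linarith
    have htη : t < η := by have := min_le_right δ η; linarith
    have hl := hball (y := e - t) (by rw [Real.dist_eq, abs_lt]; constructor <;> linarith)
      (by linarith)
    have hr := hball (y := e + t) (by rw [Real.dist_eq, abs_lt]; constructor <;> linarith)
      (by linarith)
    have hev : ∀ᶠ k in 𝓝 k₀, Real.cos k ∈ uIcc (P.y1 (e - t) 1) (P.y1 e 1) ∧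
        Real.cos k ∈ uIcc (P.y1 e 1) (P.y1 (e + t) 1) := by
      rcases mul_self_eq_one_iff.1 ((sq _).symm.trans ha) with h1 | h1
      · have m1 : P.y1 (e - t) 1 < Real.cos k₀ := by rw [← hek, h1]; nlinarith
        have m2 : P.y1 (e + t) 1 < Real.cos k₀ := by rw [← hek, h1]; nlinarith
        filter_upwards [hcosc.continuousAt.eventually (lt_mem_nhds m1),
          hcosc.continuousAt.eventually (lt_mem_nhds m2)] with k hk1 hk2
        have := Real.cos_le_one k
        rw [h1]
        exact ⟨mem_uIcc.2 (Or.inl ⟨hk1.le, this⟩), mem_uIcc.2 (Or.inr ⟨hk2.le, this⟩)⟩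
      · have m1 : Real.cos k₀ < P.y1 (e - t) 1 := by rw [← hek, h1]; nlinarith
        have m2 : Real.cos k₀ < P.y1 (e + t) 1 := by rw [← hek, h1]; nlinarith
        filter_upwards [hcosc.continuousAt.eventually (gt_mem_nhds m1),
          hcosc.continuousAt.eventually (gt_mem_nhds m2)] with k hk1 hk2
        have := Real.neg_one_le_cos k
        rw [h1]
        exact ⟨mem_uIcc.2 (Or.inr ⟨this, hk1.le⟩), mem_uIcc.2 (Or.inl ⟨this, hk2.le⟩)⟩
    filter_upwards [hev] with k hk
    rw [hrank]
    -- Either cos k is unchanged and e is still double, or the solutions found on the two sides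
    -- differ from e and hence from each other.
    by_cases hkk : Real.cos k = Real.cos k₀
    · have hfr : 2 ≤ Module.finrank ℂ (P.blochSpace k e) :=
        (two_le_finrank_iff hε hμ k e).2 ⟨hek.trans hkk.symm, hb, hq⟩
      have hsub : ({(e, 0), (e, 1)} : Set (ℝ × ℕ)) ⊆
          {q : ℝ × ℕ | q.1 ∈ Ioo c d ∧ q.2 < Module.finrank ℂ (P.blochSpace k q.1)} := by
        rintro q (rfl | rfl)
        · exact ⟨⟨hc, hd⟩, by simp only; omega⟩
        · exact ⟨⟨hc, hd⟩, by simp only; omega⟩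
      refine le_trans ?_ (Set.encard_le_encard hsub)
      rw [Set.encard_pair (by simp)]
      rfl
    · obtain ⟨u, hu, hu'⟩ := intermediate_value_uIcc hy.continuousOn hk.1
      obtain ⟨v, hv, hv'⟩ := intermediate_value_uIcc hy.continuousOn hk.2
      rw [uIcc_of_le (by linarith)] at hu hv
      have hue : u ≠ e := fun h => hkk (by rw [← hu', h]; exact hek)
      have hve : v ≠ e := fun h => hkk (by rw [← hv', h]; exact hek)
      have hsub : ({(u, 0), (v, 0)} : Set (ℝ × ℕ)) ⊆
          {q : ℝ × ℕ | q.1 ∈ Ioo c d ∧ q.2 < Module.finrank ℂ (P.blochSpace k q.1)} := by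
        rintro q (rfl | rfl)
        · exact ⟨⟨by linarith [hu.1], by linarith [hu.2]⟩, (finrank_pos_iff hε hμ k u).2 hu'⟩
        · exact ⟨⟨by linarith [hv.1], by linarith [hv.2]⟩, (finrank_pos_iff hε hμ k v).2 hv'⟩
      have huv : u ≠ v := (lt_of_le_of_ne hu.2 hue).trans_le hv.1 |>.ne
      refine le_trans ?_ (Set.encard_le_encard hsub)
      rw [Set.encard_pair (by simpa using huv)]
      rfl
  · have hrank : Module.finrank ℂ (P.blochSpace k₀ e) = 1 := by omega
    have hs : P.slopeY1 e e 1 ≠ 0 := by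
      refine slopeY1_one_ne_zero hε hμ ?_ ?_
      · rw [hek]; exact Real.cos_sq_le_one k₀
      · by_contra hcon
        push Not at hcon
        exact h2 (htwo.2 ⟨hek, hcon⟩)
    obtain ⟨l, r, hl, hlr, hr, hneg⟩ := exists_crossing hs hδ
    rw [hek] at hneg
    have hcont : Continuous fun k => (P.y1 l 1 - Real.cos k) * (P.y1 r 1 - Real.cos k) := by
      fun_prop
    filter_upwards [hcont.continuousAt.eventually (gt_mem_nhds hneg)] with k hk
    have hmem : Real.cos k ∈ uIcc (P.y1 l 1) (P.y1 r 1) := by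
      rcases mul_neg_iff.1 hk with h | h
      · exact mem_uIcc.2 (Or.inr ⟨by linarith, by linarith⟩)
      · exact mem_uIcc.2 (Or.inl ⟨by linarith, by linarith⟩)
    obtain ⟨u, hu, hu'⟩ := intermediate_value_uIcc hy.continuousOn hmem
    rw [uIcc_of_le hlr.le] at hu
    rw [hrank, Nat.cast_one, Set.one_le_encard_iff_nonempty]
    exact ⟨(u, 0), ⟨by linarith [hu.1], by linarith [hu.2]⟩, (finrank_pos_iff hε hμ k u).2 hu'⟩

/-- Inserting the largest energy last puts it in an interval disjoint from the range used for the
others, so the counts add. -/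
lemma sum_finrank_le_encard_near (k₀ : ℝ) (T : Finset ℝ) : ∀ c, (∀ e ∈ T, e < c) →
    ∀ᶠ k in 𝓝 k₀, ((∑ e ∈ T, Module.finrank ℂ (P.blochSpace k₀ e) : ℕ) : ℕ∞) ≤
      Set.encard {q : ℝ × ℕ | q.1 < c ∧ q.2 < Module.finrank ℂ (P.blochSpace k q.1)} := by
  induction T using Finset.induction_on_max with
  | empty => intro c _; simp
  | insert a s has ih =>
    intro c hc
    have hac : a < c := hc a (Finset.mem_insert_self a s)
    obtain ⟨c', hc'a, hc's⟩ : ∃ c', c' < a ∧ ∀ e ∈ s, e < c' := by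
      have h1 : ∀ᶠ c' in 𝓝[<] a, ∀ e ∈ s, e < c' :=
        (Filter.eventually_all_finset s).2 fun e he =>
          nhdsWithin_le_nhds (lt_mem_nhds (has e he))
      obtain ⟨c', h⟩ := (h1.and (self_mem_nhdsWithin (a := a) (s := Iio a))).exists
      exact ⟨c', h.2, h.1⟩
    filter_upwards [ih c' hc's, finrank_le_encard_near hε hμ k₀ a hc'a hac] with k h1 h2
    rw [Finset.sum_insert (fun h => (has a h).false), Nat.cast_add, add_comm]
    refine (add_le_add h1 h2).trans ?_
    rw [← Set.encard_union_eq]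
    · refine Set.encard_le_encard ?_
      rintro q (⟨hq, hm⟩ | ⟨hq, hm⟩)
      · exact ⟨hq.trans (hc'a.trans hac), hm⟩
      · exact ⟨hq.2, hm⟩
    · rw [Set.disjoint_left]
      rintro q ⟨hq, -⟩ ⟨hq', -⟩
      exact lt_asymm hq hq'.1

/-- Eigenvalues persist under small changes of the wavenumber. -/
lemma eventually_le_eigenvalueCount {j : ℕ} {k₀ E : ℝ} (h : (j : ℕ∞) ≤ P.eigenvalueCount k₀ E) :
    ∀ᶠ k in 𝓝 k₀, (j : ℕ∞) ≤ P.eigenvalueCount k (E + 1) := by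
  classical
  obtain ⟨t, hts, htj⟩ := Set.exists_subset_encard_eq h
  have hfin : t.Finite := Set.finite_of_encard_eq_coe htj
  lift t to Finset (ℝ × ℕ) using hfin
  rw [Set.encard_coe_eq_coe_finsetCard, Nat.cast_inj] at htj
  set T := t.image Prod.fst with hT
  -- The added 1 is room for the eigenvalues to move upwards.
  have hlt : ∀ e ∈ T, e < E + 1 := by
    intro e he
    obtain ⟨q, hq, rfl⟩ := Finset.mem_image.1 he
    have := (hts hq).1
    linarith
  have hcard : j ≤ ∑ e ∈ T, Module.finrank ℂ (P.blochSpace k₀ e) := by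
    have hsub : t ⊆ T.biUnion fun e =>
        ({e} : Finset ℝ) ×ˢ Finset.range (Module.finrank ℂ (P.blochSpace k₀ e)) := by
      intro q hq
      rw [Finset.mem_biUnion]
      exact ⟨q.1, Finset.mem_image_of_mem _ hq, by simpa using (hts hq).2⟩
    rw [← htj]
    refine (Finset.card_le_card hsub).trans (Finset.card_biUnion_le.trans ?_)
    simp
  filter_upwards [sum_finrank_le_encard_near hε hμ k₀ T (E + 1) hlt] with k hk
  refine ((Nat.cast_le.2 hcard).trans hk).trans (Set.encard_le_encard ?_)
  exact fun q hq => ⟨hq.1.le, hq.2⟩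

/-- Local persistence and compactness. It keeps the set under the supremum in `bandMax` bounded
above; otherwise the real supremum would take the default value 0. -/
lemma exists_uniform_energy {j : ℕ} {K : Set ℝ} (hK : IsCompact K)
    (h : ∀ k ∈ K, ∃ E, (j : ℕ∞) ≤ P.eigenvalueCount k E) :
    ∃ E, ∀ k ∈ K, (j : ℕ∞) ≤ P.eigenvalueCount k E := by
  refine hK.induction_on (p := fun s => ∃ E, ∀ k ∈ s, (j : ℕ∞) ≤ P.eigenvalueCount k E)
    ⟨0, by simp⟩ ?_ ?_ ?_
  · rintro s t hst ⟨E, hE⟩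
    exact ⟨E, fun k hk => hE k (hst hk)⟩
  · rintro s t ⟨E, hE⟩ ⟨E', hE'⟩
    refine ⟨max E E', ?_⟩
    rintro k (hk | hk)
    · exact (hE k hk).trans (P.eigenvalueCount_mono k (le_max_left _ _))
    · exact (hE' k hk).trans (P.eigenvalueCount_mono k (le_max_right _ _))
  · intro k hk
    obtain ⟨E, hE⟩ := h k hk
    exact ⟨_, mem_nhdsWithin_of_mem_nhds (eventually_le_eigenvalueCount hε hμ hE), E + 1,
      fun k hk => hk⟩

/-! ### Energy windows of isolated bands -/

lemma bddBelow_energies {j : ℕ} (hj : 1 ≤ j) (k : ℝ) :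
    BddBelow {E : ℝ | (j : ℕ∞) ≤ P.eigenvalueCount k E} :=
  ⟨0, fun _ hE => nonneg_of_le_eigenvalueCount hε hμ hj hE⟩

/-- This includes the case of fewer than j eigenvalues, where the infimum of the empty set is 0. -/
lemma dispersion_nonneg {j : ℕ} (hj : 1 ≤ j) (k : ℝ) : 0 ≤ P.dispersion j k :=
  Real.sInf_nonneg fun _ hE => nonneg_of_le_eigenvalueCount hε hμ hj hE

lemma bandMin_le_dispersion {j : ℕ} (hj : 1 ≤ j) {k : ℝ} (hk : k ∈ Icc (-Real.pi) Real.pi) :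
    P.bandMin j ≤ P.dispersion j k := by
  refine csInf_le ⟨0, ?_⟩ (mem_image_of_mem _ hk)
  rintro _ ⟨k, -, rfl⟩
  exact dispersion_nonneg hε hμ hj k

lemma dispersion_le_bandMax {j : ℕ} (hj : 1 ≤ j)
    (h : ∀ k ∈ Icc (-Real.pi) Real.pi, ∃ E, (j : ℕ∞) ≤ P.eigenvalueCount k E)
    {k : ℝ} (hk : k ∈ Icc (-Real.pi) Real.pi) : P.dispersion j k ≤ P.bandMax j := by
  obtain ⟨E, hE⟩ := exists_uniform_energy hε hμ isCompact_Icc h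
  refine le_csSup ⟨E, ?_⟩ (mem_image_of_mem _ hk)
  rintro _ ⟨k, hk, rfl⟩
  exact csInf_le (bddBelow_energies hε hμ hj k) (hE k hk)

lemma bandMax_nonneg {j : ℕ} (hj : 1 ≤ j) : 0 ≤ P.bandMax j := by
  refine Real.sSup_nonneg ?_
  rintro _ ⟨k, -, rfl⟩
  exact dispersion_nonneg hε hμ hj k

lemma eigenvalueCount_lt_of_lt_dispersion {j : ℕ} (hj : 1 ≤ j) {k E : ℝ}
    (h : E < P.dispersion j k) : P.eigenvalueCount k E < j := by
  by_contra hcon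
  exact notMem_of_lt_csInf h (bddBelow_energies hε hμ hj k) (not_lt.1 hcon)

omit hε hμ in
lemma le_eigenvalueCount_of_dispersion_lt {j : ℕ} {k E : ℝ}
    (hne : ∃ E, (j : ℕ∞) ≤ P.eigenvalueCount k E) (h : P.dispersion j k < E) :
    (j : ℕ∞) ≤ P.eigenvalueCount k E := by
  obtain ⟨E', hE', hlt⟩ := exists_lt_of_csInf_lt hne h
  exact le_trans hE' (P.eigenvalueCount_mono k hlt.le)

omit hε hμ in
/-- If exactly one eigenvalue is added between `L` and `U`, it is simple and equals `E_j`. -/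
lemma unique_eigenvalue_between {j : ℕ} {k L U : ℝ} (hL : P.eigenvalueCount k L < j)
    (hL' : (j : ℕ∞) ≤ P.eigenvalueCount k L + 1) (hU : P.eigenvalueCount k U < (j + 1 : ℕ))
    (hU' : (j : ℕ∞) ≤ P.eigenvalueCount k U) :
    Module.finrank ℂ (P.blochSpace k (P.dispersion j k)) = 1 ∧
      ∀ e, L < e → e ≤ U → 0 < Module.finrank ℂ (P.blochSpace k e) → e = P.dispersion j k := by
  have hLU : L < U := by
    by_contra h
    exact (hU'.trans (P.eigenvalueCount_mono k (not_lt.1 h))).not_gt hL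
  set S : ℝ → Set (ℝ × ℕ) := fun E =>
    {q : ℝ × ℕ | q.1 ≤ E ∧ q.2 < Module.finrank ℂ (P.blochSpace k q.1)} with hS
  have hcount : ∀ E, P.eigenvalueCount k E = (S E).encard := fun E => rfl
  rw [hcount] at hL hL' hU hU'
  have hsub : S L ⊆ S U := fun q hq => ⟨hq.1.trans hLU.le, hq.2⟩
  -- The hypotheses pin the counts at L and U to j - 1 and j.
  have hD : (S U \ S L).encard = 1 := by
    have h1 := Set.encard_sdiff_add_encard_of_subset hsub
    have hfU : (S U).encard ≠ ⊤ := (hU.trans_le le_top).ne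
    have hfL : (S L).encard ≠ ⊤ := (hL.trans_le le_top).ne
    have hfD : (S U \ S L).encard ≠ ⊤ := by
      intro h; rw [h, top_add] at h1; exact hfU h1.symm
    lift (S U).encard to ℕ using hfU with u
    lift (S L).encard to ℕ using hfL with l
    lift (S U \ S L).encard to ℕ using hfD with d
    norm_cast at *
    omega
  obtain ⟨⟨e, m⟩, hq⟩ := Set.encard_eq_one.1 hD
  have hmemD : ∀ e' m', L < e' → e' ≤ U → m' < Module.finrank ℂ (P.blochSpace k e') →
      (e', m') = (e, m) := by
    intro e' m' h1 h2 h3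
    have : (e', m') ∈ S U \ S L := ⟨⟨h2, h3⟩, fun h => h1.not_ge h.1⟩
    rwa [hq] at this
  have heD : (e, m) ∈ S U \ S L := by rw [hq]; rfl
  have heL : L < e := by
    by_contra h
    exact heD.2 ⟨not_lt.1 h, heD.1.2⟩
  have heU : e ≤ U := heD.1.1
  have hm : m < Module.finrank ℂ (P.blochSpace k e) := heD.1.2
  -- Lower multiplicity indices at e also belong to the difference, so m = 0; a multiplicity above 1
  -- would add a second pair.
  have hm0 : m = 0 := by
    have := hmemD e 0 heL heU (by omega)
    simpa using (congrArg Prod.snd this).symm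
  have hrank : Module.finrank ℂ (P.blochSpace k e) = 1 := by
    by_contra hne
    have := congrArg Prod.snd (hmemD e 1 heL heU (by omega))
    simp only at this
    omega
  have hdisp : P.dispersion j k = e := by
    refine IsLeast.csInf_eq ⟨?_, ?_⟩
    · refine hU'.trans (Set.encard_le_encard fun q hqU => ?_)
      by_cases hqL : q ∈ S L
      · exact ⟨hqL.1.trans heL.le, hqL.2⟩
      · have : q ∈ S U \ S L := ⟨hqU, hqL⟩
        rw [hq] at this
        rw [this]
        exact ⟨le_rfl, hm⟩
    · intro E hE
      by_contra hlt
      push Not at hlt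
      have hsubE : S E ⊆ S L := by
        intro q hqE
        by_contra hqL
        have : q ∈ S U \ S L := ⟨⟨hqE.1.trans (hlt.le.trans heU), hqE.2⟩, hqL⟩
        rw [hq] at this
        have h1 : q.1 = e := by rw [this]
        exact (h1 ▸ hqE.1).not_gt hlt
      exact ((show (j : ℕ∞) ≤ (S E).encard from hE).trans
        (Set.encard_le_encard hsubE)).not_gt hL
  rw [hdisp]
  exact ⟨hrank, fun e' h1 h2 h3 => congrArg Prod.fst (hmemD e' 0 h1 h2 h3)⟩

/-- The energies of an isolated band fill a compact interval in which, at every wavenumber, `E_j`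
is the only eigenvalue; it is simple. -/
lemma IsIsolatedBand.exists_window {j : ℕ} (hj : 1 ≤ j) (hiso : P.IsIsolatedBand j) :
    ∃ L U : ℝ, ∀ k ∈ Icc (-Real.pi) Real.pi, P.dispersion j k ∈ Icc L U ∧
      Module.finrank ℂ (P.blochSpace k (P.dispersion j k)) = 1 ∧
      ∀ e ∈ Icc L U, 0 < Module.finrank ℂ (P.blochSpace k e) → e = P.dispersion j k := by
  obtain ⟨hlow, hup⟩ := hiso
  have hnext : ∀ k ∈ Icc (-Real.pi) Real.pi,
      ∃ E, ((j + 1 : ℕ) : ℕ∞) ≤ P.eigenvalueCount k E := by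
    intro k hk
    by_contra hcon
    -- With too few eigenvalues at k, E_{j+1}(k) would be the default 0, so that E_{j+1}^- ≤ 0 ≤
    -- E_j^+, against isolation.
    have hempty : {E : ℝ | ((j + 1 : ℕ) : ℕ∞) ≤ P.eigenvalueCount k E} = ∅ :=
      Set.eq_empty_iff_forall_notMem.2 fun E hE => hcon ⟨E, hE⟩
    have h0 : P.dispersion (j + 1) k = 0 := by rw [dispersion, hempty, Real.sInf_empty]
    have h1 := bandMin_le_dispersion hε hμ (j := j + 1) (by omega) hk
    have h2 := bandMax_nonneg hε hμ hj
    linarith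
  have hprev : ∀ i ≤ j + 1, ∀ k ∈ Icc (-Real.pi) Real.pi,
      ∃ E, (i : ℕ∞) ≤ P.eigenvalueCount k E := fun i hi k hk =>
    (hnext k hk).imp fun E hE => (Nat.cast_le.2 hi).trans hE
  obtain ⟨El, hE1, hE2⟩ : ∃ El, El < P.bandMin j ∧ ∀ k ∈ Icc (-Real.pi) Real.pi,
      (j : ℕ∞) ≤ P.eigenvalueCount k El + 1 := by
    rcases Nat.lt_or_ge 1 j with h1 | h1
    · obtain ⟨El, h2, h3⟩ := exists_between (hlow h1)
      refine ⟨El, h3, fun k hk => ?_⟩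
      have h4 := dispersion_le_bandMax hε hμ (j := j - 1) (by omega)
        (hprev (j - 1) (by omega)) hk
      have h5 := le_eigenvalueCount_of_dispersion_lt (hprev (j - 1) (by omega) k hk)
        (h4.trans_lt h2)
      calc (j : ℕ∞) = ((j - 1 : ℕ) : ℕ∞) + 1 := by
            exact_mod_cast (Nat.sub_add_cancel hj).symm
        _ ≤ _ := by gcongr
    -- For j = 1 any energy below the band serves, since the required count is 0.
    · have : j = 1 := le_antisymm h1 hj
      refine ⟨P.bandMin j - 1, by linarith, fun k _ => ?_⟩
      subst this
      simp
  obtain ⟨Eu, hE3, hE4⟩ := exists_between hup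
  -- The closed window starts at E_j^-, strictly above El, and so lies in the range El < e ≤ Eu
  -- where uniqueness holds.
  refine ⟨P.bandMin j, Eu, fun k hk => ?_⟩
  have hmin := bandMin_le_dispersion hε hμ hj hk
  have hmax := dispersion_le_bandMax hε hμ hj (hprev j (by omega)) hk
  have hmin' := bandMin_le_dispersion hε hμ (j := j + 1) (by omega) hk
  obtain ⟨h1, h2⟩ := unique_eigenvalue_between (P := P) (j := j) (k := k) (L := El) (U := Eu)
    (eigenvalueCount_lt_of_lt_dispersion hε hμ hj (hE1.trans_le hmin)) (hE2 k hk)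
    (eigenvalueCount_lt_of_lt_dispersion hε hμ (by omega) (hE4.trans_le hmin'))
    (le_eigenvalueCount_of_dispersion_lt (hprev j (by omega) k hk) (hmax.trans_lt hE3))
  exact ⟨⟨hmin, hmax.trans hE3.le⟩, h1, fun e he hr => h2 e (hE1.trans_le he.1) he.2 hr⟩

end PhotonicStructure

/-! ### Real coefficients of the modes and regularity of the dispersion relation -/

namespace PhotonicStructure

variable (P : PhotonicStructure)

/-- For real α, β the two summands are the real and imaginary parts, so there is no cross term. -/
lemma normX_combination (E α β : ℝ) :
    P.normX (fun x => (α : ℂ) * P.y1 E x + Complex.I * β * P.y2 E x) =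
      Real.sqrt (α ^ 2 * P.normSq1 E + β ^ 2 * P.normSq2 E) := by
  have hn : ∀ x, ‖(α : ℂ) * P.y1 E x + Complex.I * β * P.y2 E x‖ ^ 2 =
      α ^ 2 * (P.y1 E x * P.y1 E x) + β ^ 2 * (P.y2 E x * P.y2 E x) := by
    intro x
    rw [← Complex.normSq_eq_norm_sq, Complex.normSq_apply]
    simp
    ring
  have i1 := P.isCoefficient_ε.intervalIntegrable_mul
    (h := fun t => P.y1 E t * P.y1 E t) (by fun_prop) 0 1
  have i2 := P.isCoefficient_ε.intervalIntegrable_mul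
    (h := fun t => P.y2 E t * P.y2 E t) (by fun_prop) 0 1
  rw [normX, normSq1, normSq2, crossIntegral, crossIntegral,
    ← intervalIntegral.integral_const_mul, ← intervalIntegral.integral_const_mul,
    ← intervalIntegral.integral_add (i1.const_mul _) (i2.const_mul _)]
  congr 1
  refine intervalIntegral.integral_congr fun x _ => ?_
  simp only [hn]
  ring

/-- The norm of the unnormalized mode. -/
noncomputable def rawNorm (j : ℕ) (k : ℝ) : ℝ :=
  Real.sqrt (P.y2 (P.dispersion j k) 1 ^ 2 * P.normSq1 (P.dispersion j k) +
    Real.sin k ^ 2 * P.normSq2 (P.dispersion j k))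

open Classical in
/-- The coefficient of `y1` in the normalized mode. -/
noncomputable def modeCoeff1 (j : ℕ) (k : ℝ) : ℝ :=
  if P.y2 (P.dispersion j k) 1 = 0 ∧ Real.sin k = 0 then 0
  else P.y2 (P.dispersion j k) 1 / P.rawNorm j k

open Classical in
/-- The coefficient of `i y2` in the normalized mode. -/
noncomputable def modeCoeff2 (j : ℕ) (k : ℝ) : ℝ :=
  if P.y2 (P.dispersion j k) 1 = 0 ∧ Real.sin k = 0 then
    1 / Real.sqrt (P.normSq2 (P.dispersion j k))
  else Real.sin k / P.rawNorm j k

/-- The complex combination `α y1 + i β y2` at energy `E`, with parameters `(α, β, E)`. -/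
noncomputable def combination (p : ℝ × ℝ × ℝ) (x : ℝ) : ℂ :=
  (p.1 : ℂ) * P.y1 p.2.2 x + Complex.I * p.2.1 * P.y2 p.2.2 x

lemma continuous_combination : Continuous fun q : (ℝ × ℝ × ℝ) × ℝ => P.combination q.1 q.2 := by
  unfold combination; fun_prop

lemma rawNorm_pos {j : ℕ} {k : ℝ}
    (h : ¬ (P.y2 (P.dispersion j k) 1 = 0 ∧ Real.sin k = 0)) : 0 < P.rawNorm j k := by
  refine Real.sqrt_pos.2 ?_
  have p1 := P.normSq1_pos (P.dispersion j k)
  have p2 := P.normSq2_pos (P.dispersion j k)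
  by_cases hb : P.y2 (P.dispersion j k) 1 = 0
  · have hs : Real.sin k ≠ 0 := fun hs => h ⟨hb, hs⟩
    positivity
  · positivity

lemma modeCoeff_normalized (j : ℕ) (k : ℝ) :
    P.modeCoeff1 j k ^ 2 * P.normSq1 (P.dispersion j k) +
      P.modeCoeff2 j k ^ 2 * P.normSq2 (P.dispersion j k) = 1 := by
  have p1 := P.normSq1_pos (P.dispersion j k)
  have p2 := P.normSq2_pos (P.dispersion j k)
  by_cases h : P.y2 (P.dispersion j k) 1 = 0 ∧ Real.sin k = 0
  · rw [modeCoeff1, modeCoeff2, if_pos h, if_pos h, div_pow, Real.sq_sqrt p2.le]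
    field_simp
    ring
  · have hN := P.rawNorm_pos h
    have hsq : P.rawNorm j k ^ 2 = P.y2 (P.dispersion j k) 1 ^ 2 * P.normSq1 (P.dispersion j k) +
        Real.sin k ^ 2 * P.normSq2 (P.dispersion j k) := Real.sq_sqrt (by positivity)
    rw [modeCoeff1, modeCoeff2, if_neg h, if_neg h]
    field_simp
    exact hsq.symm

variable {P} (hε : ∀ x, P.ε (-x) = P.ε x) (hμ : ∀ x, P.μ (-x) = P.μ x)

include hε hμ

lemma combination_neg (p : ℝ × ℝ × ℝ) (x : ℝ) :
    P.combination p (-x) = P.combination (p.1, -p.2.1, p.2.2) x := by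
  simp only [combination, y1_neg hε hμ, y2_neg hε hμ]
  push_cast
  ring

omit hε hμ in
lemma conj_combination (p : ℝ × ℝ × ℝ) (x : ℝ) :
    (starRingEnd ℂ) (P.combination p x) = P.combination (p.1, -p.2.1, p.2.2) x := by
  simp only [combination, map_add, map_mul, Complex.conj_ofReal, Complex.conj_I]
  push_cast
  ring

omit hε hμ in
lemma conj_mem_blochSpace {k E : ℝ} {ψ : ℝ → ℂ} (h : ψ ∈ P.blochSpace (-k) E) :
    (fun x => (starRingEnd ℂ) (ψ x)) ∈ P.blochSpace k E := by
  rw [blochSpace_eq_map] at h ⊢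
  obtain ⟨v, ⟨h1, h2⟩, rfl⟩ := h
  have hexp : (starRingEnd ℂ) (Complex.exp (Complex.I * ((-k : ℝ) : ℂ))) =
      Complex.exp (Complex.I * k) := by
    rw [← Complex.exp_conj]
    simp
  have h1' := congrArg (starRingEnd ℂ) h1
  have h2' := congrArg (starRingEnd ℂ) h2
  simp only [map_add, map_mul, Complex.conj_ofReal, hexp] at h1' h2'
  refine ⟨((starRingEnd ℂ) v.1, (starRingEnd ℂ) v.2), ⟨h1', h2'⟩, ?_⟩
  funext x
  simp [solutionMap]

section Isolated

variable {j : ℕ} (hj : 1 ≤ j) (hiso : P.IsIsolatedBand j)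

include hj hiso

lemma y1_dispersion {k : ℝ} (hk : k ∈ Icc (-Real.pi) Real.pi) :
    P.y1 (P.dispersion j k) 1 = Real.cos k := by
  obtain ⟨L, U, h⟩ := hiso.exists_window hε hμ hj
  obtain ⟨-, h1, -⟩ := h k hk
  exact (finrank_pos_iff hε hμ k _).1 (by omega)

lemma y2_ne_zero_or_q1_ne_zero {k : ℝ} (hk : k ∈ Icc (-Real.pi) Real.pi) :
    P.y2 (P.dispersion j k) 1 ≠ 0 ∨ P.q1 (P.dispersion j k) 1 ≠ 0 := by
  obtain ⟨L, U, h⟩ := hiso.exists_window hε hμ hj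
  obtain ⟨-, h1, -⟩ := h k hk
  by_contra hcon
  push Not at hcon
  have := (two_le_finrank_iff hε hμ k _).2 ⟨y1_dispersion hε hμ hj hiso hk, hcon⟩
  omega

lemma slopeY1_dispersion_ne_zero {k : ℝ} (hk : k ∈ Icc (-Real.pi) Real.pi) :
    P.slopeY1 (P.dispersion j k) (P.dispersion j k) 1 ≠ 0 := by
  refine slopeY1_one_ne_zero hε hμ ?_ (y2_ne_zero_or_q1_ne_zero hε hμ hj hiso hk)
  rw [y1_dispersion hε hμ hj hiso hk]
  exact Real.cos_sq_le_one k

/-- The dispersion relation of an isolated band is continuous. -/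
lemma continuousOn_dispersion : ContinuousOn (P.dispersion j) (Icc (-Real.pi) Real.pi) := by
  obtain ⟨L, U, h⟩ := hiso.exists_window hε hμ hj
  intro k₀ hk₀
  have hmem : ∀ᶠ k in 𝓝[Icc (-Real.pi) Real.pi] k₀, k ∈ Icc (-Real.pi) Real.pi :=
    self_mem_nhdsWithin
  -- Any limit energy y in the compact window satisfies a(y) = cos k₀, and the only eigenvalue there
  -- is E_j(k₀).
  refine isCompact_Icc.tendsto_nhds_of_unique_mapClusterPt (s := Icc L U)
    (hmem.mono fun k hk => (h k hk).1) fun y hy hcl => ?_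
  refine (h k₀ hk₀).2.2 y hy ((finrank_pos_iff hε hμ k₀ y).2 ?_)
  have hc : Continuous fun x => P.y1 x 1 := by fun_prop
  have h1 : MapClusterPt (P.y1 y 1) (𝓝[Icc (-Real.pi) Real.pi] k₀)
      ((fun x => P.y1 x 1) ∘ P.dispersion j) := hcl.continuousAt_comp hc.continuousAt
  have h2 : Tendsto ((fun x => P.y1 x 1) ∘ P.dispersion j)
      (𝓝[Icc (-Real.pi) Real.pi] k₀) (𝓝 (Real.cos k₀)) := by
    refine (Real.continuous_cos.continuousAt.mono_left nhdsWithin_le_nhds).congr' ?_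
    filter_upwards [hmem] with k hk
    exact (y1_dispersion hε hμ hj hiso hk).symm
  exact eq_of_nhds_neBot (ClusterPt.mono h1 h2)

lemma dispersion_sub_mul_slope {k k₀ : ℝ} (hk : k ∈ Icc (-Real.pi) Real.pi)
    (hk₀ : k₀ ∈ Icc (-Real.pi) Real.pi) :
    (P.dispersion j k - P.dispersion j k₀) *
      P.slopeY1 (P.dispersion j k₀) (P.dispersion j k) 1 = Real.cos k - Real.cos k₀ := by
  rw [← y1_dispersion hε hμ hj hiso hk, ← y1_dispersion hε hμ hj hiso hk₀,
    P.y1_eq_add_slope (P.dispersion j k₀) (P.dispersion j k) 1]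
  ring

/-- The dispersion relation of an isolated band is differentiable inside the zone. -/
lemma exists_hasDerivAt_dispersion {k₀ : ℝ} (hk₀ : k₀ ∈ Ioo (-Real.pi) Real.pi) :
    ∃ d, HasDerivAt (P.dispersion j) d k₀ := by
  have hk₀' := Ioo_subset_Icc_self hk₀
  have hcont : ContinuousAt (P.dispersion j) k₀ :=
    (continuousOn_dispersion hε hμ hj hiso).continuousAt (Icc_mem_nhds hk₀.1 hk₀.2)
  have hs : Continuous fun e => P.slopeY1 (P.dispersion j k₀) e 1 := by fun_prop
  have hσ := hs.continuousAt.comp (f := P.dispersion j) (x := k₀) hcont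
  have hne := slopeY1_dispersion_ne_zero hε hμ hj hiso hk₀'
  -- Implicit differentiation of a(E_j(k)) = cos k, carried out with the exact difference quotient.
  refine ⟨-Real.sin k₀ / P.slopeY1 (P.dispersion j k₀) (P.dispersion j k₀) 1, ?_⟩
  rw [hasDerivAt_iff_tendsto_slope]
  have hcos := hasDerivAt_iff_tendsto_slope.1 (Real.hasDerivAt_cos k₀)
  have hlim := hcos.div (hσ.tendsto.mono_left nhdsWithin_le_nhds) hne
  refine hlim.congr' ?_
  have hev := nhdsWithin_le_nhds (s := {k₀}ᶜ)
    (hσ.eventually (isOpen_ne.mem_nhds hne))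
  filter_upwards [hev, nhdsWithin_le_nhds (Icc_mem_nhds hk₀.1 hk₀.2), self_mem_nhdsWithin]
    with k hk1 hk2 hk3
  have hkk : k - k₀ ≠ 0 := sub_ne_zero.2 hk3
  have hk1' : P.slopeY1 (P.dispersion j k₀) (P.dispersion j k) 1 ≠ 0 := hk1
  simp only [Function.comp_apply, Pi.div_apply]
  rw [slope_def_field, slope_def_field, ← dispersion_sub_mul_slope hε hμ hj hiso hk2 hk₀']
  field_simp

/-- On the band a = cos k, so e^{ik} - a = i sin k. -/
lemma rawMode_eq {k : ℝ} (hk : k ∈ Icc (-Real.pi) Real.pi) : P.rawMode j k =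
    P.combination (P.y2 (P.dispersion j k) 1, Real.sin k, P.dispersion j k) := by
  funext x
  simp only [rawMode, psi1_eq, psi2_eq, combination, exp_eq_cos_add,
    y1_dispersion hε hμ hj hiso hk]
  ring

lemma normX_rawMode {k : ℝ} (hk : k ∈ Icc (-Real.pi) Real.pi) :
    P.normX (P.rawMode j k) = P.rawNorm j k := by
  rw [rawMode_eq hε hμ hj hiso hk]
  exact P.normX_combination _ _ _

lemma rawMode_eq_zero_iff {k : ℝ} (hk : k ∈ Icc (-Real.pi) Real.pi) :
    P.rawMode j k = 0 ↔ P.y2 (P.dispersion j k) 1 = 0 ∧ Real.sin k = 0 := by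
  constructor
  · intro h
    by_contra hcon
    have h1 := P.rawNorm_pos hcon
    rw [← normX_rawMode hε hμ hj hiso hk, h] at h1
    simp [normX] at h1
  · rintro ⟨h1, h2⟩
    rw [rawMode_eq hε hμ hj hiso hk, h1, h2]
    funext x
    simp [combination]

lemma normalizedMode_eq {k : ℝ} (hk : k ∈ Icc (-Real.pi) Real.pi) : P.normalizedMode j k =
    P.combination (P.modeCoeff1 j k, P.modeCoeff2 j k, P.dispersion j k) := by
  funext x
  by_cases h : P.y2 (P.dispersion j k) 1 = 0 ∧ Real.sin k = 0
  · have h0 := (rawMode_eq_zero_iff hε hμ hj hiso hk).2 h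
    have hn : P.normX (P.psi2 (P.dispersion j k)) =
        Real.sqrt (P.normSq2 (P.dispersion j k)) := by
      rw [psi2_eq]
      have h3 := P.normX_combination (P.dispersion j k) 0 1
      rw [show (0 : ℝ) ^ 2 * P.normSq1 (P.dispersion j k) +
        1 ^ 2 * P.normSq2 (P.dispersion j k) = P.normSq2 (P.dispersion j k) by ring] at h3
      rw [← h3]
      simp [normX]
    rw [normalizedMode, if_neg (not_not.2 h0), combination, modeCoeff1, modeCoeff2, if_pos h,
      if_pos h, hn, psi2_eq]
    push_cast
    ring
  · have h0 : P.rawMode j k ≠ 0 := fun h0 => h ((rawMode_eq_zero_iff hε hμ hj hiso hk).1 h0)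
    rw [normalizedMode, if_pos h0, normX_rawMode hε hμ hj hiso hk, combination, modeCoeff1,
      modeCoeff2, if_neg h, if_neg h, rawMode_eq hε hμ hj hiso hk, combination]
    push_cast
    ring

lemma normX_normalizedMode {k : ℝ} (hk : k ∈ Icc (-Real.pi) Real.pi) :
    P.normX (P.normalizedMode j k) = 1 := by
  rw [normalizedMode_eq hε hμ hj hiso hk]
  refine (P.normX_combination _ _ _).trans ?_
  rw [modeCoeff_normalized, Real.sqrt_one]

lemma normalizedMode_mem {k : ℝ} (hk : k ∈ Icc (-Real.pi) Real.pi) :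
    P.normalizedMode j k ∈ P.blochSpace k (P.dispersion j k) := by
  have hy := y1_dispersion hε hμ hj hiso hk
  by_cases h : P.y2 (P.dispersion j k) 1 = 0 ∧ Real.sin k = 0
  -- For b = 0 and sin k = 0 the solution `y2` is itself a Bloch mode, with multiplier `q2 E 1` =
  -- cos k = e^{ik}.
  · have hm : (fun x => (P.y2 (P.dispersion j k) x : ℂ)) ∈
        P.blochSpace k (P.dispersion j k) := by
      rw [blochSpace_eq_map]
      refine ⟨(0, 1), ⟨?_, ?_⟩, ?_⟩
      · simp [h.1]
      · rw [q2_one hε hμ, hy, exp_eq_cos_add, h.2]; simp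
      · funext x; simp [solutionMap]
    have := Submodule.smul_mem _ (Complex.I * P.modeCoeff2 j k) hm
    rw [normalizedMode_eq hε hμ hj hiso hk]
    convert this using 1
    funext x
    rw [combination, modeCoeff1, if_pos h]
    simp
  · have h0 : P.rawMode j k ≠ 0 := fun h0 => h ((rawMode_eq_zero_iff hε hμ hj hiso hk).1 h0)
    have hm : P.rawMode j k ∈ P.blochSpace k (P.dispersion j k) := by
      rw [blochSpace_eq_map, rawMode_eq hε hμ hj hiso hk]
      refine ⟨(P.y2 (P.dispersion j k) 1, Complex.I * Real.sin k), ⟨?_, ?_⟩, ?_⟩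
      · simp only [hy, exp_eq_cos_add]; ring
      · have hd : (Real.cos k : ℂ) ^ 2 - P.y2 (P.dispersion j k) 1 * P.q1 (P.dispersion j k) 1
            = 1 := by
          rw [← hy]; exact_mod_cast det_monodromy hε hμ (P.dispersion j k)
        have hsc : (Real.sin k : ℂ) ^ 2 + (Real.cos k : ℂ) ^ 2 = 1 := by
          exact_mod_cast Real.sin_sq_add_cos_sq k
        simp only [q2_one hε hμ, hy, exp_eq_cos_add]
        linear_combination -hd + hsc - (Real.sin k : ℂ) ^ 2 * Complex.I_sq
      · rfl
    have := Submodule.smul_mem _ ((P.normX (P.rawMode j k) : ℂ)⁻¹) hm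
    convert this using 1
    funext x
    rw [normalizedMode, if_pos h0]
    simp [div_eq_inv_mul]

omit hj hiso hε hμ in
lemma blochMode_of_nonneg {k : ℝ} (hk : 0 ≤ k) : P.blochMode j k = P.normalizedMode j k := by
  funext x; rw [blochMode, if_pos hk]

/-- The coefficients of `y1` and i `y2` are real, so reflecting x and conjugating both flip the sign
of the second one. -/
lemma blochMode_of_neg {k : ℝ} (hk : k ∈ Ico (-Real.pi) 0) (x : ℝ) :
    P.blochMode j k x = (starRingEnd ℂ) (P.normalizedMode j (-k) x) := by
  have hk' : -k ∈ Icc (-Real.pi) Real.pi := ⟨by linarith [hk.2, Real.pi_pos], by linarith [hk.1]⟩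
  rw [blochMode, if_neg (not_le.2 hk.2), normalizedMode_eq hε hμ hj hiso hk',
    combination_neg hε hμ, conj_combination]

lemma blochMode_mem_and_normX {k : ℝ} (hk : k ∈ Ioc (-Real.pi) Real.pi) :
    P.blochMode j k ∈ P.blochSpace k (P.dispersion j k) ∧ P.normX (P.blochMode j k) = 1 := by
  have hkI := Ioc_subset_Icc_self hk
  rcases le_or_gt 0 k with h | h
  · rw [blochMode_of_nonneg h]
    exact ⟨normalizedMode_mem hε hμ hj hiso hkI, normX_normalizedMode hε hμ hj hiso hkI⟩
  · have hk' : -k ∈ Icc (-Real.pi) Real.pi := ⟨by linarith [Real.pi_pos], by linarith [hk.1]⟩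
    rw [funext (blochMode_of_neg hε hμ hj hiso ⟨hk.1.le, h⟩)]
    constructor
    · rw [← dispersion_neg hε hμ]
      exact conj_mem_blochSpace (normalizedMode_mem hε hμ hj hiso hk')
    · rw [← normX_normalizedMode hε hμ hj hiso hk']
      simp only [normX, RCLike.norm_conj]

/-- At the ends of the half zone the mode is even or odd. -/
lemma even_or_odd_normalizedMode {k : ℝ} (hk : k ∈ Icc (-Real.pi) Real.pi)
    (hs : Real.sin k = 0) :
    Function.Even (P.normalizedMode j k) ∨ Function.Odd (P.normalizedMode j k) := by
  rw [normalizedMode_eq hε hμ hj hiso hk]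
  -- For b = 0 the mode is a multiple of the odd `y2`; otherwise sin k = 0 leaves a multiple of the
  -- even `y1`.
  by_cases h : P.y2 (P.dispersion j k) 1 = 0
  · right
    intro x
    rw [combination_neg hε hμ]
    simp only [combination, modeCoeff1, if_pos (And.intro h hs)]
    push_cast
    ring
  · left
    intro x
    rw [combination_neg hε hμ]
    simp only [combination, modeCoeff2, hs, h, false_and, if_false]
    simp

end Isolated

end PhotonicStructure

/-! ### Limits at the ends of the half zone and vanishing of the connection -/

/-- The integral over a period of a conjugation-symmetric periodic function is real. -/
lemma conj_integral_eq_self_of_symmetric {W : ℝ → ℂ} (hp : ∀ x, W (x + 1) = W x)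
    (hn : ∀ x, W (-x) = (starRingEnd ℂ) (W x)) :
    (starRingEnd ℂ) (∫ x in (0 : ℝ)..1, W x) = ∫ x in (0 : ℝ)..1, W x := by
  have hper : Function.Periodic W 1 := hp
  rw [← intervalIntegral.intervalIntegral_conj]
  simp only [← hn]
  rw [intervalIntegral.integral_comp_neg, neg_zero]
  have := hper.intervalIntegral_add_eq (-1) 0
  simpa using this

lemma HasDerivAt.complex_conj {f : ℝ → ℂ} {f' : ℂ} {x : ℝ} (h : HasDerivAt f f' x) :
    HasDerivAt (fun y => (starRingEnd ℂ) (f y)) ((starRingEnd ℂ) f') x := h.star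

namespace PhotonicStructure

variable {P : PhotonicStructure} (hε : ∀ x, P.ε (-x) = P.ε x) (hμ : ∀ x, P.μ (-x) = P.μ x)

include hε hμ

variable {j : ℕ} (hj : 1 ≤ j) (hiso : P.IsIsolatedBand j)

include hj hiso

/-- At a degenerate end of the half zone, the coefficient of `y1` vanishes faster than that of
`y2`. -/
lemma tendsto_ratio_of_degenerate {k₀ : ℝ} (hk₀ : k₀ ∈ Icc 0 Real.pi) (hs : Real.sin k₀ = 0)
    (hb : P.y2 (P.dispersion j k₀) 1 = 0) :
    Tendsto (fun k => P.y2 (P.dispersion j k) 1 / Real.sin k) (𝓝[Ioo 0 Real.pi] k₀) (𝓝 0) := by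
  have hπ := Real.pi_pos
  have hsub : Ioo 0 Real.pi ⊆ Icc (-Real.pi) Real.pi := fun k hk =>
    ⟨by linarith [hk.1], hk.2.le⟩
  have hk₀' : k₀ ∈ Icc (-Real.pi) Real.pi := ⟨by linarith [hk₀.1], hk₀.2⟩
  have he : Tendsto (P.dispersion j) (𝓝[Ioo 0 Real.pi] k₀) (𝓝 (P.dispersion j k₀)) :=
    (continuousOn_dispersion hε hμ hj hiso k₀ hk₀').mono_left (nhdsWithin_mono _ hsub)
  have hc1 : Continuous fun e => P.slopeY1 (P.dispersion j k₀) e 1 := by fun_prop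
  have hc2 : Continuous fun e => P.slopeY2 (P.dispersion j k₀) e 1 := by fun_prop
  have t1 := (hc1.tendsto _).comp he
  have t2 := (hc2.tendsto _).comp he
  have t3 : Tendsto Real.sin (𝓝[Ioo 0 Real.pi] k₀) (𝓝 (Real.sin k₀)) :=
    Real.continuous_sin.continuousAt.mono_left nhdsWithin_le_nhds
  have t4 : Tendsto (fun k => Real.cos k + Real.cos k₀) (𝓝[Ioo 0 Real.pi] k₀)
      (𝓝 (Real.cos k₀ + Real.cos k₀)) :=
    (Real.continuous_cos.add continuous_const).continuousAt.mono_left nhdsWithin_le_nhds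
  have hne1 := slopeY1_dispersion_ne_zero hε hμ hj hiso hk₀'
  have hne2 : Real.cos k₀ + Real.cos k₀ ≠ 0 := by
    have := Real.sin_sq_add_cos_sq k₀
    intro h
    have h0 : Real.cos k₀ = 0 := by linarith
    rw [hs, h0] at this
    norm_num at this
  -- Multiplying (E - E₀) slopeY1 = cos k - cos k₀ by cos k + cos k₀ gives -sin² k on the right,
  -- since sin k₀ = 0. As b = (E - E₀) slopeY2, this yields b / sin k = -sin k slopeY2 / ((cos k +
  -- cos k₀) slopeY1).
  have hlim := (t3.mul t2).neg.div (t4.mul t1) (mul_ne_zero hne2 hne1)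
  rw [hs, zero_mul, neg_zero, zero_div] at hlim
  refine hlim.congr' ?_
  filter_upwards [self_mem_nhdsWithin, t1.eventually (isOpen_ne.mem_nhds hne1),
    t4.eventually (isOpen_ne.mem_nhds hne2)] with k hk h1 h2
  have hsin : Real.sin k ≠ 0 := (Real.sin_pos_of_mem_Ioo hk).ne'
  have hy := P.y2_eq_add_slope (P.dispersion j k₀) (P.dispersion j k) 1
  have hd := dispersion_sub_mul_slope hε hμ hj hiso (hsub hk) hk₀'
  rw [hb, zero_add] at hy
  simp only [Function.comp_apply, Pi.div_apply] at h1 h2 ⊢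
  rw [hy, div_eq_div_iff (mul_ne_zero h2 h1) hsin]
  have e1 := Real.sin_sq_add_cos_sq k
  have e2 := Real.sin_sq_add_cos_sq k₀
  rw [hs] at e2
  linear_combination (-(P.slopeY2 (P.dispersion j k₀) (P.dispersion j k) 1) *
    (Real.cos k + Real.cos k₀)) * hd +
    (P.slopeY2 (P.dispersion j k₀) (P.dispersion j k) 1) * (e2 - e1)

lemma tendsto_modeCoeff {k₀ : ℝ} (hk₀ : k₀ ∈ Icc 0 Real.pi) (hs : Real.sin k₀ = 0) :
    Tendsto (fun k => (P.modeCoeff1 j k, P.modeCoeff2 j k, P.dispersion j k))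
      (𝓝[Ioo 0 Real.pi] k₀)
      (𝓝 (P.modeCoeff1 j k₀, P.modeCoeff2 j k₀, P.dispersion j k₀)) := by
  have hπ := Real.pi_pos
  have hsub : Ioo 0 Real.pi ⊆ Icc (-Real.pi) Real.pi := fun k hk =>
    ⟨by linarith [hk.1], hk.2.le⟩
  have hk₀' : k₀ ∈ Icc (-Real.pi) Real.pi := ⟨by linarith [hk₀.1], hk₀.2⟩
  have he : Tendsto (P.dispersion j) (𝓝[Ioo 0 Real.pi] k₀) (𝓝 (P.dispersion j k₀)) :=
    (continuousOn_dispersion hε hμ hj hiso k₀ hk₀').mono_left (nhdsWithin_mono _ hsub)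
  have t3 : Tendsto Real.sin (𝓝[Ioo 0 Real.pi] k₀) (𝓝 (Real.sin k₀)) :=
    Real.continuous_sin.continuousAt.mono_left nhdsWithin_le_nhds
  have n1 := (P.continuous_normSq1.tendsto _).comp he
  have n2 := (P.continuous_normSq2.tendsto _).comp he
  have hcond : ∀ᶠ k in 𝓝[Ioo 0 Real.pi] k₀,
      ¬ (P.y2 (P.dispersion j k) 1 = 0 ∧ Real.sin k = 0) := by
    filter_upwards [self_mem_nhdsWithin] with k hk h
    exact (Real.sin_pos_of_mem_Ioo hk).ne' h.2
  suffices h : Tendsto (P.modeCoeff1 j) (𝓝[Ioo 0 Real.pi] k₀) (𝓝 (P.modeCoeff1 j k₀)) ∧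
      Tendsto (P.modeCoeff2 j) (𝓝[Ioo 0 Real.pi] k₀) (𝓝 (P.modeCoeff2 j k₀)) from
    h.1.prodMk_nhds (h.2.prodMk_nhds he)
  by_cases hb : P.y2 (P.dispersion j k₀) 1 = 0
  · have hρ := tendsto_ratio_of_degenerate hε hμ hj hiso hk₀ hs hb
    have hroot := (((hρ.pow 2).mul n1).add n2).sqrt
    have hp := P.normSq2_pos (P.dispersion j k₀)
    rw [zero_pow two_ne_zero, zero_mul, zero_add] at hroot
    have hr0 := (Real.sqrt_pos.2 hp).ne'
    -- Dividing by sin k leaves only the ratio b / sin k → 0. The sign sin k > 0 selects the limit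
    -- +i y2 / ‖y2‖.
    have hN : ∀ k ∈ Ioo 0 Real.pi, P.rawNorm j k = Real.sin k *
        Real.sqrt ((P.y2 (P.dispersion j k) 1 / Real.sin k) ^ 2 *
          P.normSq1 (P.dispersion j k) + P.normSq2 (P.dispersion j k)) := by
      intro k hk
      have hsin := Real.sin_pos_of_mem_Ioo hk
      rw [rawNorm]
      conv_rhs => rw [← Real.sqrt_sq hsin.le, ← Real.sqrt_mul (sq_nonneg _), Real.sqrt_sq hsin.le]
      congr 1
      field_simp
    have hz : P.y2 (P.dispersion j k₀) 1 = 0 ∧ Real.sin k₀ = 0 := ⟨hb, hs⟩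
    constructor
    · have hlim := hρ.div hroot hr0
      rw [zero_div] at hlim
      rw [modeCoeff1, if_pos hz]
      refine hlim.congr' ?_
      filter_upwards [self_mem_nhdsWithin, hcond] with k hk hck
      have hsin := Real.sin_pos_of_mem_Ioo hk
      rw [modeCoeff1, if_neg hck, hN k hk]
      simp only [Pi.div_apply, Function.comp_apply]
      rw [div_div]
    · have hlim := (tendsto_const_nhds (x := (1 : ℝ))).div hroot hr0
      rw [modeCoeff2, if_pos hz]
      refine hlim.congr' ?_
      filter_upwards [self_mem_nhdsWithin, hcond] with k hk hck
      have hsin := Real.sin_pos_of_mem_Ioo hk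
      rw [modeCoeff2, if_neg hck, hN k hk]
      simp only [Pi.div_apply, Function.comp_apply]
      rw [div_mul_eq_div_div, div_self hsin.ne']
  · have hc : Continuous fun e => P.y2 e 1 := by fun_prop
    have t1 := (hc.tendsto _).comp he
    have hN : Tendsto (P.rawNorm j) (𝓝[Ioo 0 Real.pi] k₀) (𝓝 (P.rawNorm j k₀)) :=
      (((t1.pow 2).mul n1).add ((t3.pow 2).mul n2)).sqrt
    have hz : ¬ (P.y2 (P.dispersion j k₀) 1 = 0 ∧ Real.sin k₀ = 0) := fun h => hb h.1
    have hN0 := (P.rawNorm_pos hz).ne'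
    constructor
    · rw [modeCoeff1, if_neg hz]
      refine (t1.div hN hN0).congr' ?_
      filter_upwards [hcond] with k hk
      rw [modeCoeff1, if_neg hk]
      rfl
    · rw [modeCoeff2, if_neg hz]
      refine (t3.div hN hN0).congr' ?_
      filter_upwards [hcond] with k hk
      rw [modeCoeff2, if_neg hk]
      rfl

lemma differentiableAt_modeCoeff {k : ℝ} (hk : k ∈ Ioo 0 Real.pi) :
    DifferentiableAt ℝ (P.modeCoeff1 j) k ∧ DifferentiableAt ℝ (P.modeCoeff2 j) k := by
  have hsin := Real.sin_pos_of_mem_Ioo hk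
  obtain ⟨d, hd⟩ := exists_hasDerivAt_dispersion hε hμ hj hiso (k₀ := k)
    ⟨by linarith [hk.1, Real.pi_pos], hk.2⟩
  have hb : DifferentiableAt ℝ (fun κ => P.y2 (P.dispersion j κ) 1) k :=
    ((P.hasDerivAt_y2 (P.dispersion j k) 1).comp k hd).differentiableAt
  have h1 : DifferentiableAt ℝ (fun κ => P.normSq1 (P.dispersion j κ)) k :=
    ((P.hasDerivAt_normSq1 (P.dispersion j k)).comp k hd).differentiableAt
  have h2 : DifferentiableAt ℝ (fun κ => P.normSq2 (P.dispersion j κ)) k :=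
    ((P.hasDerivAt_normSq2 (P.dispersion j k)).comp k hd).differentiableAt
  have hs : DifferentiableAt ℝ Real.sin k := Real.differentiableAt_sin
  have hNpos := P.rawNorm_pos (j := j) (k := k) fun h => hsin.ne' h.2
  have hN : DifferentiableAt ℝ (P.rawNorm j) k :=
    (((hb.pow 2).mul h1).add ((hs.pow 2).mul h2)).sqrt (Real.sqrt_pos.1 hNpos).ne'
  have hev : ∀ᶠ κ in 𝓝 k, ¬ (P.y2 (P.dispersion j κ) 1 = 0 ∧ Real.sin κ = 0) := by
    filter_upwards [isOpen_Ioo.mem_nhds hk] with κ hκ h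
    exact (Real.sin_pos_of_mem_Ioo hκ).ne' h.2
  constructor
  · refine (hb.div hN hNpos.ne').congr_of_eventuallyEq ?_
    filter_upwards [hev] with κ hκ
    rw [modeCoeff1, if_neg hκ]
    rfl
  · refine (hs.div hN hNpos.ne').congr_of_eventuallyEq ?_
    filter_upwards [hev] with κ hκ
    rw [modeCoeff2, if_neg hκ]
    rfl

lemma blochMode_eq_combination {k : ℝ} (hk : k ∈ Icc 0 Real.pi) : P.blochMode j k =
    P.combination (P.modeCoeff1 j k, P.modeCoeff2 j k, P.dispersion j k) := by
  rw [blochMode_of_nonneg hk.1, normalizedMode_eq hε hμ hj hiso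
    ⟨by linarith [hk.1, Real.pi_pos], hk.2⟩]

lemma blochMode_neg_eq_combination {k : ℝ} (hk : k ∈ Ioc 0 Real.pi) : P.blochMode j (-k) =
    P.combination (P.modeCoeff1 j k, -P.modeCoeff2 j k, P.dispersion j k) := by
  funext x
  rw [blochMode_of_neg hε hμ hj hiso ⟨by linarith [hk.2], by linarith [hk.1]⟩, neg_neg,
    normalizedMode_eq hε hμ hj hiso ⟨by linarith [hk.1, Real.pi_pos], hk.2⟩, conj_combination]

lemma periodicPart_add_one {k : ℝ} (hk : k ∈ Ioc (-Real.pi) Real.pi) (x : ℝ) :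
    periodicPart (P.blochMode j) k (x + 1) = periodicPart (P.blochMode j) k x := by
  have h := (blochMode_mem_and_normX hε hμ hj hiso hk).1.2 x
  rw [periodicPart, periodicPart, h, ← mul_assoc, ← Complex.exp_add]
  congr 2
  push_cast
  ring

/-- Reflection in x conjugates the factor e^{-ikx} as well as the mode. -/
lemma periodicPart_neg {k : ℝ} (hk : k ∈ Icc 0 Real.pi) (x : ℝ) :
    periodicPart (P.blochMode j) k (-x) =
      (starRingEnd ℂ) (periodicPart (P.blochMode j) k x) := by
  rw [periodicPart, periodicPart, blochMode_eq_combination hε hμ hj hiso hk,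
    combination_neg hε hμ, map_mul, conj_combination, ← Complex.exp_conj]
  simp

lemma periodicPart_neg_wavenumber {k : ℝ} (hk : k ∈ Ioc 0 Real.pi) (x : ℝ) :
    periodicPart (P.blochMode j) (-k) x =
      (starRingEnd ℂ) (periodicPart (P.blochMode j) k x) := by
  rw [periodicPart, periodicPart, blochMode_eq_combination hε hμ hj hiso ⟨hk.1.le, hk.2⟩,
    blochMode_neg_eq_combination hε hμ hj hiso hk, map_mul, conj_combination, ← Complex.exp_conj]
  simp

/-- Derivative of the modes in the wavenumber, in terms of real functions. -/
lemma exists_hasDerivAt_periodicPart {k : ℝ} (hk : k ∈ Ioo 0 Real.pi) :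
    ∃ F' G' : ℝ → ℝ, Continuous F' ∧ Continuous G' ∧
      (∀ x, HasDerivAt (fun κ => periodicPart (P.blochMode j) κ x)
        (Complex.exp (-(Complex.I * k * x)) * (F' x + Complex.I * G' x -
          Complex.I * x * P.blochMode j k x)) k) ∧
      ∫ x in (0 : ℝ)..1, P.ε x * (F' x * (P.modeCoeff1 j k * P.y1 (P.dispersion j k) x) +
        G' x * (P.modeCoeff2 j k * P.y2 (P.dispersion j k) x)) = 0 := by
  obtain ⟨d, hd⟩ := exists_hasDerivAt_dispersion hε hμ hj hiso (k₀ := k)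
    ⟨by linarith [hk.1, Real.pi_pos], hk.2⟩
  obtain ⟨hA, hB⟩ := differentiableAt_modeCoeff hε hμ hj hiso hk
  replace hA := hA.hasDerivAt
  replace hB := hB.hasDerivAt
  set A := P.modeCoeff1 j k
  set B := P.modeCoeff2 j k
  set E := P.dispersion j k
  set A' := deriv (P.modeCoeff1 j) k
  set B' := deriv (P.modeCoeff2 j) k
  refine ⟨fun x => A' * P.y1 E x + A * (P.slopeY1 E E x * d),
    fun x => B' * P.y2 E x + B * (P.slopeY2 E E x * d), by fun_prop, by fun_prop,
    fun x => ?_, ?_⟩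
  · have h1 := hA.mul ((P.hasDerivAt_y1 E x).comp k hd)
    have h2 := hB.mul ((P.hasDerivAt_y2 E x).comp k hd)
    have hexp : HasDerivAt (fun κ : ℝ => Complex.exp (-(Complex.I * κ * x)))
        (Complex.exp (-(Complex.I * k * x)) * (-(Complex.I * x))) k := by
      have h3 : HasDerivAt (fun κ : ℝ => -(Complex.I * (κ : ℂ) * x)) (-(Complex.I * x)) k := by
        have := (((hasDerivAt_id k).ofReal_comp.const_mul Complex.I).mul_const (x : ℂ)).neg
        exact this.congr_deriv (by simp)
      exact h3.cexp
    have h4 := hexp.mul (h1.ofReal_comp.add (h2.ofReal_comp.const_mul Complex.I))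
    have h5 : (fun κ => periodicPart (P.blochMode j) κ x) =ᶠ[𝓝 k] fun κ : ℝ =>
        Complex.exp (-(Complex.I * κ * x)) *
          (((P.modeCoeff1 j κ * P.y1 (P.dispersion j κ) x : ℝ) : ℂ) +
          Complex.I * ((P.modeCoeff2 j κ * P.y2 (P.dispersion j κ) x : ℝ) : ℂ)) := by
      filter_upwards [isOpen_Ioo.mem_nhds hk] with κ hκ
      rw [periodicPart, blochMode_eq_combination hε hμ hj hiso (Ioo_subset_Icc_self hκ),
        combination]
      push_cast
      ring
    refine (h4.congr_of_eventuallyEq h5).congr_deriv ?_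
    rw [blochMode_eq_combination hε hμ hj hiso (Ioo_subset_Icc_self hk), combination]
    simp only [Pi.mul_apply, Function.comp_apply, Pi.add_apply]
    push_cast
    ring
  -- The integral is half the k-derivative of the squared norm of the mode, which is identically 1.
  · have hconst : HasDerivAt (fun κ => P.modeCoeff1 j κ ^ 2 * P.normSq1 (P.dispersion j κ) +
        P.modeCoeff2 j κ ^ 2 * P.normSq2 (P.dispersion j κ)) 0 k := by
      simp only [modeCoeff_normalized]
      exact hasDerivAt_const k 1
    have hder := ((hA.pow 2).mul ((P.hasDerivAt_normSq1 E).comp k hd)).add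
      ((hB.pow 2).mul ((P.hasDerivAt_normSq2 E).comp k hd))
    have hzero := hder.unique hconst
    have i1 := P.isCoefficient_ε.intervalIntegrable_mul
      (h := fun t => P.y1 E t * P.y1 E t) (by fun_prop) 0 1
    have i2 := P.isCoefficient_ε.intervalIntegrable_mul
      (h := fun t => P.y2 E t * P.y2 E t) (by fun_prop) 0 1
    have i3 := P.isCoefficient_ε.intervalIntegrable_mul
      (h := fun t => P.y1 E t * P.slopeY1 E E t) (by fun_prop) 0 1
    have i4 := P.isCoefficient_ε.intervalIntegrable_mul
      (h := fun t => P.y2 E t * P.slopeY2 E E t) (by fun_prop) 0 1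
    have hsplit : ∫ x in (0 : ℝ)..1, P.ε x * ((A' * P.y1 E x + A * (P.slopeY1 E E x * d)) *
          (A * P.y1 E x) + (B' * P.y2 E x + B * (P.slopeY2 E E x * d)) * (B * P.y2 E x)) =
        A * A' * P.normSq1 E + B * B' * P.normSq2 E +
        A ^ 2 * d * (∫ t in (0 : ℝ)..1, P.ε t * (P.y1 E t * P.slopeY1 E E t)) +
        B ^ 2 * d * (∫ t in (0 : ℝ)..1, P.ε t * (P.y2 E t * P.slopeY2 E E t)) := by
      rw [normSq1, normSq2, crossIntegral, crossIntegral]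
      rw [← intervalIntegral.integral_const_mul, ← intervalIntegral.integral_const_mul,
        ← intervalIntegral.integral_const_mul, ← intervalIntegral.integral_const_mul,
        ← intervalIntegral.integral_add (i1.const_mul _) (i2.const_mul _),
        ← intervalIntegral.integral_add ((i1.const_mul _).add (i2.const_mul _)) (i3.const_mul _),
        ← intervalIntegral.integral_add (((i1.const_mul _).add (i2.const_mul _)).add
          (i3.const_mul _)) (i4.const_mul _)]
      refine intervalIntegral.integral_congr fun x _ => ?_
      ring
    rw [hsplit]
    simp only [Function.comp_apply, Pi.pow_apply, Nat.cast_ofNat, Nat.add_one_sub_one,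
      pow_one] at hzero
    change 2 * A * A' * P.normSq1 E + A ^ 2 * _ + (2 * B * B' * P.normSq2 E + B ^ 2 * _) = 0
      at hzero
    linarith

lemma differentiableAt_periodicPart {k : ℝ} (hk : k ∈ Ioo 0 Real.pi) (x : ℝ) :
    DifferentiableAt ℝ (fun κ => periodicPart (P.blochMode j) κ x) k := by
  obtain ⟨F', G', -, -, hD, -⟩ := exists_hasDerivAt_periodicPart hε hμ hj hiso hk
  exact (hD x).differentiableAt

/-- The explicit derivative contains a factor x, but periodicity holds for all nearby wavenumbers
and survives differentiation. -/
lemma periodicPartDeriv_add_one {k : ℝ} (hk : k ∈ Ioo 0 Real.pi) (x : ℝ) :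
    periodicPartDeriv (P.blochMode j) k (x + 1) = periodicPartDeriv (P.blochMode j) k x := by
  refine Filter.EventuallyEq.deriv_eq ?_
  filter_upwards [isOpen_Ioo.mem_nhds hk] with κ hκ
  exact periodicPart_add_one hε hμ hj hiso ⟨by linarith [hκ.1, Real.pi_pos], hκ.2.le⟩ x

lemma periodicPartDeriv_neg {k : ℝ} (hk : k ∈ Ioo 0 Real.pi) (x : ℝ) :
    periodicPartDeriv (P.blochMode j) k (-x) =
      (starRingEnd ℂ) (periodicPartDeriv (P.blochMode j) k x) := by
  have h := (differentiableAt_periodicPart hε hμ hj hiso hk x).hasDerivAt.complex_conj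
  refine (h.congr_of_eventuallyEq ?_).deriv
  filter_upwards [isOpen_Ioo.mem_nhds hk] with κ hκ
  exact periodicPart_neg hε hμ hj hiso (Ioo_subset_Icc_self hκ) x

lemma hasDerivAt_periodicPart_neg_wavenumber {k : ℝ} (hk : k ∈ Ioo 0 Real.pi) (x : ℝ) :
    HasDerivAt (fun κ => periodicPart (P.blochMode j) κ x)
      (-(starRingEnd ℂ) (periodicPartDeriv (P.blochMode j) k x)) (-k) := by
  have h0 : HasDerivAt (fun κ => periodicPart (P.blochMode j) κ x)
      (periodicPartDeriv (P.blochMode j) k x) (- -k) := by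
    rw [neg_neg]; exact (differentiableAt_periodicPart hε hμ hj hiso hk x).hasDerivAt
  have h := (h0.scomp (-k) (hasDerivAt_neg (-k))).complex_conj
  refine (h.congr_of_eventuallyEq ?_).congr_deriv (by simp)
  have hmem : Ioo (-Real.pi) 0 ∈ 𝓝 (-k) :=
    isOpen_Ioo.mem_nhds ⟨by linarith [hk.2], by linarith [hk.1]⟩
  filter_upwards [hmem] with κ hκ
  have := periodicPart_neg_wavenumber hε hμ hj hiso (k := -κ)
    ⟨by linarith [hκ.2], by linarith [hκ.1]⟩ x
  rw [neg_neg] at this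
  exact this

/-- The integrand of the connection is integrable over the unit cell, and the connection
vanishes. -/
lemma connection_eq_zero_of_pos {k : ℝ} (hk : k ∈ Ioo 0 Real.pi) :
    IntervalIntegrable (fun x => (P.ε x : ℂ) * periodicPartDeriv (P.blochMode j) k x *
      (starRingEnd ℂ) (periodicPart (P.blochMode j) k x)) volume 0 1 ∧
    P.connection (P.blochMode j) k = 0 := by
  obtain ⟨F', G', hF', hG', hD, hzero⟩ := exists_hasDerivAt_periodicPart hε hμ hj hiso hk
  have hmode := blochMode_eq_combination hε hμ hj hiso (Ioo_subset_Icc_self hk)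
  set A := P.modeCoeff1 j k
  set B := P.modeCoeff2 j k
  set E := P.dispersion j k
  -- R and S are the real and imaginary parts of the integrand divided by ε. The normalization kills
  -- the integral of ε R.
  set R : ℝ → ℝ := fun x => F' x * (A * P.y1 E x) + G' x * (B * P.y2 E x) with hR
  set S : ℝ → ℝ := fun x => G' x * (A * P.y1 E x) - F' x * (B * P.y2 E x) -
    x * ((A * P.y1 E x) ^ 2 + (B * P.y2 E x) ^ 2) with hS
  have hRc : Continuous R := by fun_prop
  have hSc : Continuous S := by fun_prop
  have hint : ∀ x, (P.ε x : ℂ) * periodicPartDeriv (P.blochMode j) k x *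
      (starRingEnd ℂ) (periodicPart (P.blochMode j) k x) =
      P.ε x * ((R x : ℂ) + Complex.I * S x) := by
    intro x
    have hd : periodicPartDeriv (P.blochMode j) k x = _ := (hD x).deriv
    have hee : Complex.exp (-(Complex.I * k * x)) *
        (starRingEnd ℂ) (Complex.exp (-(Complex.I * k * x))) = 1 := by
      rw [← Complex.exp_conj, ← Complex.exp_add]
      simp
    rw [hd, periodicPart, map_mul, hmode, conj_combination, combination, combination, hR, hS]
    push_cast
    linear_combination (P.ε x * ((F' x + Complex.I * G' x -
      Complex.I * x * (A * P.y1 E x + Complex.I * B * P.y2 E x)) *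
      (A * P.y1 E x - Complex.I * B * P.y2 E x)) : ℂ) * hee +
      P.ε x * (-(G' x : ℂ) * (B * P.y2 E x) + Complex.I * x * B ^ 2 * P.y2 E x ^ 2) *
        Complex.I_sq
  refine ⟨?_, ?_⟩
  · simp only [hint]
    exact P.isCoefficient_ε.intervalIntegrable_mul_complex
      (h := fun x => (R x : ℂ) + Complex.I * S x) (by fun_prop) 0 1
  have hofReal : ∀ f : ℝ → ℝ, Continuous f →
      IntervalIntegrable (fun x => ((P.ε x * f x : ℝ) : ℂ)) volume 0 1 := fun f hf => by
    have h := P.isCoefficient_ε.intervalIntegrable_mul hf 0 1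
    exact ⟨h.1.ofReal, h.2.ofReal⟩
  have hconn : P.connection (P.blochMode j) k =
      Complex.I * ((∫ x in (0 : ℝ)..1, P.ε x * S x : ℝ) : ℂ) := by
    rw [connection, innerX]
    simp only [hint]
    have h1 : (∫ x in (0 : ℝ)..1, ((P.ε x * R x : ℝ) : ℂ)) = 0 := by
      rw [intervalIntegral.integral_ofReal, hzero, Complex.ofReal_zero]
    rw [← intervalIntegral.integral_ofReal, ← intervalIntegral.integral_const_mul,
      ← zero_add (∫ x in (0 : ℝ)..1, Complex.I * ((P.ε x * S x : ℝ) : ℂ)), ← h1,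
      ← intervalIntegral.integral_add (hofReal R hRc) ((hofReal S hSc).const_mul _)]
    refine intervalIntegral.integral_congr fun x _ => ?_
    push_cast
    ring
  -- The inversion symmetry makes the connection real, while the normalization made it purely
  -- imaginary.
  have hsymm : (starRingEnd ℂ) (P.connection (P.blochMode j) k) =
      P.connection (P.blochMode j) k := by
    refine conj_integral_eq_self_of_symmetric (fun x => ?_) fun x => ?_
    · rw [P.ε_periodic, periodicPartDeriv_add_one hε hμ hj hiso hk,
        periodicPart_add_one hε hμ hj hiso ⟨by linarith [hk.1, Real.pi_pos], hk.2.le⟩]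
    · rw [hε, periodicPartDeriv_neg hε hμ hj hiso hk,
        periodicPart_neg hε hμ hj hiso (Ioo_subset_Icc_self hk)]
      simp only [map_mul, Complex.conj_ofReal]
  rw [hconn] at hsymm ⊢
  simp only [map_mul, Complex.conj_I, Complex.conj_ofReal] at hsymm
  linear_combination (-1 / 2 : ℂ) * hsymm

/-- The periodic part at k is the conjugate of that at -k; the chain rule adds a sign, so the
integrand is minus the conjugate of the one at -k. -/
lemma connection_eq_zero_of_neg {k : ℝ} (hk : k ∈ Ioo (-Real.pi) 0) :
    IntervalIntegrable (fun x => (P.ε x : ℂ) * periodicPartDeriv (P.blochMode j) k x *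
      (starRingEnd ℂ) (periodicPart (P.blochMode j) k x)) volume 0 1 ∧
    P.connection (P.blochMode j) k = 0 := by
  have hk' : -k ∈ Ioo 0 Real.pi := ⟨by linarith [hk.2], by linarith [hk.1]⟩
  obtain ⟨hi, hc⟩ := connection_eq_zero_of_pos hε hμ hj hiso hk'
  have hint : ∀ x, (P.ε x : ℂ) * periodicPartDeriv (P.blochMode j) k x *
      (starRingEnd ℂ) (periodicPart (P.blochMode j) k x) =
      -(starRingEnd ℂ) ((P.ε x : ℂ) * periodicPartDeriv (P.blochMode j) (-k) x *
        (starRingEnd ℂ) (periodicPart (P.blochMode j) (-k) x)) := by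
    intro x
    have h1 := (hasDerivAt_periodicPart_neg_wavenumber hε hμ hj hiso hk' x).deriv
    have h2 := periodicPart_neg_wavenumber hε hμ hj hiso (k := -k) ⟨hk'.1, hk'.2.le⟩ x
    rw [neg_neg] at h1 h2
    rw [periodicPartDeriv, h1, h2]
    simp only [map_mul, Complex.conj_ofReal, Complex.conj_conj]
    ring
  constructor
  · simp only [hint]
    refine IntervalIntegrable.neg ?_
    exact ⟨Complex.conjCLE.toContinuousLinearMap.integrable_comp hi.1,
      Complex.conjCLE.toContinuousLinearMap.integrable_comp hi.2⟩
  · rw [connection, innerX]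
    simp only [hint]
    rw [intervalIntegral.integral_neg, intervalIntegral.intervalIntegral_conj]
    have : (∫ x in (0 : ℝ)..1, (P.ε x : ℂ) * periodicPartDeriv (P.blochMode j) (-k) x *
        (starRingEnd ℂ) (periodicPart (P.blochMode j) (-k) x)) = 0 := hc
    rw [this, map_zero, neg_zero]

end PhotonicStructure

/-! ### Overlaps at the ends of the half zone and the Zak phase -/

namespace PhotonicStructure

variable {P : PhotonicStructure}

/-- Joint continuity in the parameters and in x over the compact cell turns parameter convergence
into uniform convergence. -/
lemma tendstoUniformlyOn_combination {ι : Type*} {l : Filter ι} {p : ι → ℝ × ℝ × ℝ}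
    {p₀ : ℝ × ℝ × ℝ} (h : Tendsto p l (𝓝 p₀)) :
    TendstoUniformlyOn (fun i => P.combination (p i)) (P.combination p₀) l (Icc 0 1) := by
  intro u hu
  obtain ⟨v, hv, hvu⟩ := isCompact_Icc.mem_uniformity_of_prod (f := P.combination)
    (s := univ) (k := Icc (0 : ℝ) 1) (q := p₀) P.continuous_combination.continuousOn
    (mem_univ _) (symm_le_uniformity hu)
  rw [nhdsWithin_univ] at hv
  filter_upwards [h hv] with i hi x hx
  exact hvu _ hi x hx

lemma innerX_congr {f f' g g' : ℝ → ℂ} (hf : ∀ x ∈ Icc (0 : ℝ) 1, f x = f' x)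
    (hg : ∀ x ∈ Icc (0 : ℝ) 1, g x = g' x) : P.innerX f g = P.innerX f' g' := by
  refine intervalIntegral.integral_congr fun x hx => ?_
  rw [uIcc_of_le zero_le_one] at hx
  simp only [hf x hx, hg x hx]

lemma innerX_self_of_normX_eq_one {f : ℝ → ℂ} (h : P.normX f = 1) : P.innerX f f = 1 := by
  have h1 : ∫ x in (0 : ℝ)..1, P.ε x * ‖f x‖ ^ 2 = 1 := by
    rwa [normX, Real.sqrt_eq_one] at h
  have h2 : P.innerX f f = ∫ x in (0 : ℝ)..1, ((P.ε x * ‖f x‖ ^ 2 : ℝ) : ℂ) := by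
    refine intervalIntegral.integral_congr fun x _ => ?_
    rw [mul_assoc, Complex.mul_conj, Complex.normSq_eq_norm_sq]
    push_cast
    ring
  rw [h2, intervalIntegral.integral_ofReal, h1, Complex.ofReal_one]

/-- The overlap of a normalized mode with its mirror image is its parity. -/
lemma innerX_reflect_right {f : ℝ → ℂ} (h : P.normX f = 1) :
    (Function.Even f → P.innerX f (fun x => f (-x)) = 1) ∧
      (Function.Odd f → P.innerX f (fun x => f (-x)) = -1) := by
  have h1 := innerX_self_of_normX_eq_one h
  constructor
  · intro he
    rw [← h1]
    exact congrArg _ (funext he)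
  · intro ho
    rw [← h1, funext ho, innerX, innerX, ← intervalIntegral.integral_neg]
    simp

lemma innerX_reflect_left {f : ℝ → ℂ} (h : P.normX f = 1) :
    (Function.Even f → P.innerX (fun x => f (-x)) f = 1) ∧
      (Function.Odd f → P.innerX (fun x => f (-x)) f = -1) := by
  have h1 := innerX_self_of_normX_eq_one h
  constructor
  · intro he
    rw [← h1]
    exact congrArg (fun g => P.innerX g f) (funext he)
  · intro ho
    rw [← h1, funext ho, innerX, innerX, ← intervalIntegral.integral_neg]
    simp

variable (hε : ∀ x, P.ε (-x) = P.ε x) (hμ : ∀ x, P.μ (-x) = P.μ x)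

include hε hμ

variable {j : ℕ} (hj : 1 ≤ j) (hiso : P.IsIsolatedBand j)

include hj hiso

/-- Used with k₀ = 0 and k₀ = π, it identifies both one-sided limits in the Zak phase as mirror
images of the end modes. -/
lemma tendstoUniformlyOn_blochMode_neg {k₀ : ℝ} (hk₀ : k₀ ∈ Icc 0 Real.pi)
    (hs : Real.sin k₀ = 0) :
    TendstoUniformlyOn (P.blochMode j) (fun x => P.blochMode j k₀ (-x))
      (𝓝[Ioo (-Real.pi) 0] (-k₀)) (Icc 0 1) := by
  have hneg : Tendsto (fun k : ℝ => -k) (𝓝[Ioo (-Real.pi) 0] (-k₀)) (𝓝[Ioo 0 Real.pi] k₀) := by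
    refine tendsto_nhdsWithin_iff.2 ⟨?_, ?_⟩
    · have := (continuous_neg (G := ℝ)).tendsto (-k₀)
      rw [neg_neg] at this
      exact this.mono_left nhdsWithin_le_nhds
    · filter_upwards [self_mem_nhdsWithin] with k hk
      exact ⟨by linarith [hk.2], by linarith [hk.1]⟩
  have hflip : Continuous fun p : ℝ × ℝ × ℝ => (p.1, -p.2.1, p.2.2) := by fun_prop
  have hlim := (hflip.tendsto _).comp ((tendsto_modeCoeff hε hμ hj hiso hk₀ hs).comp hneg)
  have hu := tendstoUniformlyOn_combination (P := P) hlim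
  have hlimit : (fun x => P.blochMode j k₀ (-x)) =
      P.combination (P.modeCoeff1 j k₀, -P.modeCoeff2 j k₀, P.dispersion j k₀) := by
    funext x
    rw [blochMode_eq_combination hε hμ hj hiso hk₀, combination_neg hε hμ]
  rw [hlimit]
  refine hu.congr ?_
  filter_upwards [self_mem_nhdsWithin] with k hk x _
  have := blochMode_neg_eq_combination hε hμ hj hiso (k := -k)
    ⟨by linarith [hk.2], by linarith [hk.1]⟩
  rw [neg_neg] at this
  rw [this]
  rfl

/-- The Zak phase is determined by the two overlaps at the ends of the half zone. -/
lemma isZakPhase_blochMode_iff (θ : ℝ) : P.IsZakPhase (P.blochMode j) θ ↔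
    P.innerX (P.blochMode j 0) (fun x => P.blochMode j 0 (-x)) ≠ 0 ∧
    P.innerX (fun x => P.blochMode j Real.pi (-x)) (P.blochMode j Real.pi) ≠ 0 ∧
    ∃ n : ℤ, (θ : ℂ) =
      -((Complex.log (P.innerX (P.blochMode j 0) (fun x => P.blochMode j 0 (-x)))).im : ℂ) -
      ((Complex.log (P.innerX (fun x => P.blochMode j Real.pi (-x))
        (P.blochMode j Real.pi))).im : ℂ) + (n : ℂ) * (2 * (Real.pi : ℂ)) := by
  have hπ := Real.pi_pos
  have hneg := fun (k : ℝ) (hk : k ∈ Ioo (-Real.pi) 0) =>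
    connection_eq_zero_of_neg hε hμ hj hiso hk
  have hpos := fun (k : ℝ) (hk : k ∈ Ioo 0 Real.pi) =>
    connection_eq_zero_of_pos hε hμ hj hiso hk
  -- Vanishing on the open intervals suffices; the end values do not affect the integrals.
  have e1 : EqOn (fun _ => (0 : ℂ)) (P.connection (P.blochMode j)) (uIoo (-Real.pi) 0) := by
    rw [uIoo_of_le (by linarith)]
    exact fun k hk => (hneg k hk).2.symm
  have e2 : EqOn (fun _ => (0 : ℂ)) (P.connection (P.blochMode j)) (uIoo 0 Real.pi) := by
    rw [uIoo_of_le hπ.le]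
    exact fun k hk => (hpos k hk).2.symm
  have i1 : ∫ k in (-Real.pi)..0, P.connection (P.blochMode j) k = 0 := by
    rw [← intervalIntegral.integral_congr_uIoo e1]; simp
  have i2 : ∫ k in (0 : ℝ)..Real.pi, P.connection (P.blochMode j) k = 0 := by
    rw [← intervalIntegral.integral_congr_uIoo e2]; simp
  have hI0 : 𝓝[Ioo (-Real.pi) 0] (0 : ℝ) = 𝓝[<] 0 := nhdsWithin_Ioo_eq_nhdsLT (by linarith)
  have hIπ : 𝓝[Ioo (-Real.pi) 0] (-Real.pi) = 𝓝[>] (-Real.pi) :=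
    nhdsWithin_Ioo_eq_nhdsGT (by linarith)
  have u0 := tendstoUniformlyOn_blochMode_neg hε hμ hj hiso (k₀ := 0) ⟨le_rfl, hπ.le⟩
    Real.sin_zero
  have uπ := tendstoUniformlyOn_blochMode_neg hε hμ hj hiso (k₀ := Real.pi) ⟨hπ.le, le_rfl⟩
    Real.sin_pi
  rw [neg_zero, hI0] at u0
  rw [hIπ] at uπ
  constructor
  · rintro ⟨-, -, -, -, v, w, hv, hw, hv0, hw0, n, hn⟩
    -- The limits are determined on the unit cell only, which is all that the overlaps see.
    have hvE : ∀ x ∈ Icc (0 : ℝ) 1, v x = P.blochMode j 0 (-x) := fun x hx =>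
      tendsto_nhds_unique (hv.tendsto_at hx) (u0.tendsto_at hx)
    have hwE : ∀ x ∈ Icc (0 : ℝ) 1, w x = P.blochMode j Real.pi (-x) := fun x hx =>
      tendsto_nhds_unique (hw.tendsto_at hx) (uπ.tendsto_at hx)
    rw [i1, i2, innerX_congr (fun _ _ => rfl) hvE, innerX_congr hwE (fun _ _ => rfl)] at hn
    rw [innerX_congr (fun _ _ => rfl) hvE] at hv0
    rw [innerX_congr hwE (fun _ _ => rfl)] at hw0
    refine ⟨hv0, hw0, n, ?_⟩
    rw [hn]
    ring
  · rintro ⟨hv0, hw0, n, hn⟩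
    refine ⟨?_, ?_, ?_, ?_, _, _, u0, uπ, hv0, hw0, n, ?_⟩
    · rintro k (hk | hk) x
      · have := hasDerivAt_periodicPart_neg_wavenumber hε hμ hj hiso (k := -k)
          ⟨by linarith [hk.2], by linarith [hk.1]⟩ x
        rw [neg_neg] at this
        exact this.differentiableAt
      · exact differentiableAt_periodicPart hε hμ hj hiso hk x
    · rintro k (hk | hk)
      · exact (hneg k hk).1
      · exact (hpos k hk).1
    · exact intervalIntegrable_const.congr_uIoo e1
    · exact intervalIntegrable_const.congr_uIoo e2
    · rw [i1, i2, hn]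
      ring

end PhotonicStructure

lemma angle_coe_eq_coe_iff_exists_complex {θ ψ : ℝ} {z : ℂ} (hz : z = ψ) :
    (∃ n : ℤ, (θ : ℂ) = z + (n : ℂ) * (2 * (Real.pi : ℂ))) ↔
      (θ : Real.Angle) = (ψ : Real.Angle) := by
  rw [Real.Angle.angle_eq_iff_two_pi_dvd_sub, hz]
  refine exists_congr fun n => ?_
  rw [sub_eq_iff_eq_add]
  constructor
  · intro h
    have h' : θ = ψ + n * (2 * Real.pi) := by exact_mod_cast h
    rw [h']; ring
  · intro h
    rw [h]; push_cast; ring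

theorem mainTheorem2 (P : PhotonicStructure)
    (hε : ∀ x, P.ε (-x) = P.ε x) (hμ : ∀ x, P.μ (-x) = P.μ x)
    (j : ℕ) (hj : 1 ≤ j) (hiso : P.IsIsolatedBand j) :
    (∀ k ∈ Set.Ioc (-Real.pi) Real.pi,
      P.blochMode j k ∈ P.blochSpace k (P.dispersion j k) ∧ P.normX (P.blochMode j k) = 1) ∧
    (Function.Even (P.blochMode j 0) ∨ Function.Odd (P.blochMode j 0)) ∧
    (Function.Even (P.blochMode j Real.pi) ∨ Function.Odd (P.blochMode j Real.pi)) ∧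
    ((Function.Even (P.blochMode j 0) ∧ Function.Even (P.blochMode j Real.pi)) ∨
      (Function.Odd (P.blochMode j 0) ∧ Function.Odd (P.blochMode j Real.pi)) →
        ∀ θ : ℝ, P.IsZakPhase (P.blochMode j) θ ↔ (θ : Real.Angle) = 0) ∧
    ((Function.Even (P.blochMode j 0) ∧ Function.Odd (P.blochMode j Real.pi)) ∨
      (Function.Odd (P.blochMode j 0) ∧ Function.Even (P.blochMode j Real.pi)) →
        ∀ θ : ℝ, P.IsZakPhase (P.blochMode j) θ ↔ (θ : Real.Angle) = (Real.pi : Real.Angle)) := by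
  have hπ := Real.pi_pos
  have hmode := fun (k : ℝ) (hk : k ∈ Set.Ioc (-Real.pi) Real.pi) =>
    PhotonicStructure.blochMode_mem_and_normX hε hμ hj hiso hk
  have hn0 := (hmode 0 ⟨by linarith, hπ.le⟩).2
  have hnπ := (hmode Real.pi ⟨by linarith, le_rfl⟩).2
  obtain ⟨r1, r2⟩ := PhotonicStructure.innerX_reflect_right hn0
  obtain ⟨l1, l2⟩ := PhotonicStructure.innerX_reflect_left hnπ
  have hzak := PhotonicStructure.isZakPhase_blochMode_iff hε hμ hj hiso
  refine ⟨hmode, ?_, ?_, ?_, ?_⟩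
  · rw [PhotonicStructure.blochMode_of_nonneg le_rfl]
    exact PhotonicStructure.even_or_odd_normalizedMode hε hμ hj hiso ⟨by linarith, hπ.le⟩
      Real.sin_zero
  · rw [PhotonicStructure.blochMode_of_nonneg hπ.le]
    exact PhotonicStructure.even_or_odd_normalizedMode hε hμ hj hiso ⟨by linarith, le_rfl⟩
      Real.sin_pi
  · rintro (⟨h0, h1⟩ | ⟨h0, h1⟩) θ
    · rw [hzak, r1 h0, l1 h1, angle_coe_eq_coe_iff_exists_complex (ψ := 0) (by simp)]
      simp
    -- Both overlaps are -1 and each logarithm has imaginary part π, so the total is -2π.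
    · rw [hzak, r2 h0, l2 h1,
        angle_coe_eq_coe_iff_exists_complex (ψ := -Real.pi - Real.pi) (by simp [Complex.log_im])]
      have : ((-Real.pi - Real.pi : ℝ) : Real.Angle) = 0 := by
        rw [Real.Angle.coe_sub, Real.Angle.coe_neg, Real.Angle.neg_coe_pi, sub_self]
      rw [this]
      simp
  · rintro (⟨h0, h1⟩ | ⟨h0, h1⟩) θ
    -- A single overlap -1 gives -π, the same angle as π.
    · rw [hzak, r1 h0, l2 h1,
        angle_coe_eq_coe_iff_exists_complex (ψ := -Real.pi) (by simp [Complex.log_im]), Real.Angle.coe_neg,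
        Real.Angle.neg_coe_pi]
      simp
    · rw [hzak, r2 h0, l1 h1,
        angle_coe_eq_coe_iff_exists_complex (ψ := -Real.pi) (by simp [Complex.log_im]), Real.Angle.coe_neg,
        Real.Angle.neg_coe_pi]
      simp
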